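/- **Setup.** A chain of $g$ loops is the metric graph $\Gamma$ with vertices $w_0,\dots,w_g$ and $v_1,\dots,v_{g+1}$, with a bridge $\beta_k$ of length $n_k>0$ from $w_k$ to $v_{k+1}$ for $0\le k\le g$, and with two edges (the top and the bottom edge of the $k$-th loop), of lengths $\ell_k>0$ and $m_k>0$, from $v_k$ to $w_k$ for $1\le k\le g$. For integers $r\ge 0$ and $s\ge 1$ with $(r+1)s\le g$ and a real number $C>0$, write $a\ll_C b$ for $Ca<b$. The edge lengths are *admissible* (for $r,s,C$) if - $4g\,m_k<\ell_k\ll_C\min\{n_{k-1},n_k\}$ for $1\le k\le g$; - there is no nontrivial relation $c_1m_1+\dots+c_gm_g=0$ with integers $|c_k|\le g+1$; - $\sum_{i=\alpha s+1}^{(\alpha+1)s}\ell_i+\sum_{i=\alpha s+1}^{(\alpha+1)s-1}n_i\ll_C\min\{n_{\alpha s},n_{(\alpha+1)s}\}$ for every integer $0\le\alpha\le r$. For a continuous piecewise linear function $\psi$ with integer slopes on $\Gamma$, $\operatorname{div}\psi$ is the divisor whose coefficient at a point is the sum of the incoming slopes of $\psi$ there. Divisors $D,D'$ are equivalent, $D\sim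 D'$, if $D'=D+\operatorname{div}\psi$ for some such $\psi$; rank means the Baker–Norine rank. The class of a divisor $D$ of rank $r$ is *vertex avoiding* if for every $0\le i\le r$ there is a unique divisor $D_i\sim D$ of the form $D_i=iw_0+(r-i)v_{g+1}+E_i$ with $E_i$ effective, and the support of $E_i$ contains none of the vertices $w_0,\dots,w_g,v_1,\dots,v_{g+1}$. For a multiset $I$ of size $m$ in $\{0,\dots,r\}$ let $\psi_I$ be a continuous piecewise linear function with integer slopes such that $mD+\operatorname{div}\psi_I=\sum_{i\in I}D_i$; it is determined up to an additive constant. A family of functions $(\psi_I)_{I\in\mathcal A}$ on $\Gamma$ is *tropically dependent* if there are real constants $b_I$ such that at every point $x\in\Gamma$ the minimum of the numbers $\psi_I(x)+b_I$ is attained for at least two indices $I\in\mathcal A$; otherwise it is *tropically independent*. The *tropical maximal rank conjecture for $(g,r,d,m)$* is the following assertion, where $s=g-d+r$: there is a constant $C>0$, depending only on $g,r,d,m$, such that on every chain of $g$ loops whose edge lengths are admissible for $r,s,C$ there are a divisor $D$ of rank $r$ and degree $d$ whose class is vertex avoiding, and a set $\mathcal A$ of multisets of size $m$ in $\{0,\dots,r\}$,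 with $$|\mathcal A|=\min\left\{\binom{r+m}{m},\ md-g+1\right\},$$ such that $(\psi_I)_{I\in\mathcal A}$ is tropically independent. **Theorem 1.5.** Let $g\ge 3$, $r=g-1$ and $d=2g-2$ (so $s=1$). Then for every integer $m\ge 1$ the tropical maximal rank conjecture holds for $(g,r,d,m)$. -/

import Mathlib

noncomputable section

/-- A (compact) metric graph, presented by a finite multigraph with positive edge lengths.
Each edge `e` carries the orientation from `src e` to `tgt e`; it is used only to parametrize `e`
by the interval `[0, len e]`. -/
structure MetricGraph where
  /-- vertices -/
  V : Type
  /-- edges -/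
  E : Type
  [decEqV : DecidableEq V]
  [fintypeE : Fintype E]
  src : E → V
  tgt : E → V
  len : E → ℝ
  len_pos : ∀ e, 0 < len e

attribute [instance] MetricGraph.decEqV MetricGraph.fintypeE

namespace MetricGraph

variable (G : MetricGraph)

/-- The points of a metric graph: its vertices, and the interior points of its edges. -/
inductive Point : Type
  | vertex (v : G.V) : Point
  | inner (e : G.E) (t : ℝ) (h0 : 0 < t) (h1 : t < G.len e) : Point

variable {G}

/-- The point at distance `t` from the source along the edge `e`, for `0 ≤ t ≤ len e`
(`t = 0` is the source vertex and `t = len e` is the target vertex). -/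
def onEdge (e : G.E) (t : ℝ) : G.Point :=
  if h : 0 < t ∧ t < G.len e then .inner e t h.1 h.2
  else if t ≤ 0 then .vertex (G.src e) else .vertex (G.tgt e)

/-- `φ` is continuous and piecewise linear with integer slopes on `[a, b]`: there is a finite set `S`
of break points such that `φ` is affine with integer slope on every closed subinterval of `[a, b]`
whose interior misses `S`. (Continuity follows, as the pieces are closed intervals.) -/
def IsIntegralPLOn (φ : ℝ → ℝ) (a b : ℝ) : Prop :=
  ∃ S : Finset ℝ, ∀ x y : ℝ, a ≤ x → x ≤ y → y ≤ b → (∀ s ∈ S, ¬ (x < s ∧ s < y)) →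
    ∃ k : ℤ, ∀ t ∈ Set.Icc x y, φ t = φ x + k * (t - x)

/-- Membership in `PL(Γ)`: continuous piecewise linear functions with integer slopes. -/
def IsPL (f : G.Point → ℝ) : Prop :=
  ∀ e : G.E, IsIntegralPLOn (fun t => f (onEdge e t)) 0 (G.len e)

/-- The slope of `f` on `e` at parameter `t`, on the side of larger parameters,
in the direction from source to target. -/
def slopeRight (f : G.Point → ℝ) (e : G.E) (t : ℝ) : ℝ :=
  derivWithin (fun x => f (onEdge e x)) (Set.Ici t) t

/-- The slope of `f` on `e` at parameter `t`, on the side of smaller parameters,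
in the direction from source to target. -/
def slopeLeft (f : G.Point → ℝ) (e : G.E) (t : ℝ) : ℝ :=
  derivWithin (fun x => f (onEdge e x)) (Set.Iic t) t

/-- The order of `f` at a point: the sum of the incoming slopes of `f` along all tangent directions,
that is, minus the sum of the outgoing slopes. -/
def ord (f : G.Point → ℝ) : G.Point → ℝ
  | .vertex v =>
      ∑ e : G.E, ((if G.tgt e = v then slopeLeft f e (G.len e) else 0)
        - (if G.src e = v then slopeRight f e 0 else 0))
  | .inner e t _ _ => slopeLeft f e t - slopeRight f e t

variable (G) in
/-- Divisors: finite formal integer combinations of points. -/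
abbrev Divisor : Type := G.Point →₀ ℤ

/-- The degree of a divisor. -/
def deg (D : G.Divisor) : ℤ := D.sum fun _ n => n

/-- `f ∈ PL(Γ)` and `div f = D`. -/
def IsDiv (f : G.Point → ℝ) (D : G.Divisor) : Prop :=
  IsPL f ∧ ∀ p, ord f p = (D p : ℝ)

/-- Linear equivalence of divisors: `D' = D + div f` for some `f ∈ PL(Γ)`. -/
def LinEquiv (D D' : G.Divisor) : Prop := ∃ f : G.Point → ℝ, IsDiv f (D' - D)

/-- The Baker-Norine rank of `D` is at least `k`: for every effective divisor `E` of degree `k`,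
`D - E` is equivalent to an effective divisor. -/
def RankAtLeast (D : G.Divisor) (k : ℕ) : Prop :=
  ∀ E : G.Divisor, 0 ≤ E → deg E = k → ∃ D' : G.Divisor, 0 ≤ D' ∧ LinEquiv (D - E) D'

/-- The Baker-Norine rank of `D` equals the natural number `r`. -/
def HasRank (D : G.Divisor) (r : ℕ) : Prop := RankAtLeast D r ∧ ¬ RankAtLeast D (r + 1)

end MetricGraph

/-- The family `(ψ i)` indexed by `i ∈ A` is tropically dependent: for some real constants `b i`,
the minimum of the values `ψ i x + b i` occurs at least twice at every point `x`. -/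
def TropicallyDependent {X ι : Type} (A : Finset ι) (ψ : ι → X → ℝ) : Prop :=
  ∃ b : ι → ℝ, ∀ x : X, ∃ i ∈ A, ∃ j ∈ A, i ≠ j ∧
    ψ i x + b i = ψ j x + b j ∧ ∀ k ∈ A, ψ i x + b i ≤ ψ k x + b k

/-- Edge lengths for a chain of `g` loops: for `1 ≤ k ≤ g`, the top and bottom edges of the `k`-th
loop have lengths `ℓ k` and `m k`, and for `0 ≤ k ≤ g` the `k`-th bridge has length `n k`.
Values at other indices are never used. -/
structure ChainLengths (g : ℕ) where
  ℓ : ℕ → ℝ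
  m : ℕ → ℝ
  n : ℕ → ℝ
  ℓ_pos : ∀ k, 1 ≤ k → k ≤ g → 0 < ℓ k
  m_pos : ∀ k, 1 ≤ k → k ≤ g → 0 < m k
  n_pos : ∀ k, k ≤ g → 0 < n k

namespace ChainLengths

variable {g : ℕ}

/-- Admissible edge lengths, where `a ≪ b` is read as `C * a < b`. The last condition concerns the
division of the first `(r + 1) * s` loops into `r + 1` blocks of `s` consecutive loops. -/
structure Admissible (L : ChainLengths g) (r s : ℕ) (C : ℝ) : Prop where
  bottom_lt_top : ∀ k, 1 ≤ k → k ≤ g → 4 * (g : ℝ) * L.m k < L.ℓ k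
  top_ll_bridges : ∀ k, 1 ≤ k → k ≤ g → C * L.ℓ k < min (L.n (k - 1)) (L.n k)
  generic : ∀ c : ℕ → ℤ, (∀ k, 1 ≤ k → k ≤ g → |c k| ≤ (g : ℤ) + 1) →
    ∑ k ∈ Finset.Icc 1 g, (c k : ℝ) * L.m k = 0 → ∀ k, 1 ≤ k → k ≤ g → c k = 0
  blocks : ∀ α : ℕ, α ≤ r →
    C * (∑ i ∈ Finset.Icc (α * s + 1) ((α + 1) * s), L.ℓ i
        + ∑ i ∈ Finset.Ico (α * s + 1) ((α + 1) * s), L.n i)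
      < min (L.n (α * s)) (L.n ((α + 1) * s))

/-- The chain of `g` loops with bridges. The vertices are `inl k = w_k` and `inr k = v_{k+1}`, for
`0 ≤ k ≤ g`. The edges are the bridges `inl k`, from `w_k` to `v_{k+1}`, for `0 ≤ k ≤ g`, and the
top edges `inr (inl k)` and bottom edges `inr (inr k)` of the `(k+1)`-st loop, from `v_{k+1}` to
`w_{k+1}`, for `0 ≤ k < g`. -/
def graph (L : ChainLengths g) : MetricGraph where
  V := Fin (g + 1) ⊕ Fin (g + 1)
  E := Fin (g + 1) ⊕ (Fin g ⊕ Fin g)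
  src := Sum.elim (fun k => .inl k)
    (Sum.elim (fun k => .inr k.castSucc) (fun k => .inr k.castSucc))
  tgt := Sum.elim (fun k => .inr k)
    (Sum.elim (fun k => .inl k.succ) (fun k => .inl k.succ))
  len := Sum.elim (fun k => L.n k)
    (Sum.elim (fun k => L.ℓ (k + 1)) (fun k => L.m (k + 1)))
  len_pos := by
    rintro (k | k | k)
    · exact L.n_pos k (Nat.le_of_lt_succ k.isLt)
    · exact L.ℓ_pos (k + 1) (Nat.le_add_left 1 k) k.isLt
    · exact L.m_pos (k + 1) (Nat.le_add_left 1 k) k.isLt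

/-- The left end `w_0` of the chain. -/
def leftEnd (L : ChainLengths g) : L.graph.Point :=
  .vertex (.inl 0 : Fin (g + 1) ⊕ Fin (g + 1))

/-- The right end `v_{g+1}` of the chain. -/
def rightEnd (L : ChainLengths g) : L.graph.Point :=
  .vertex (.inr (Fin.last g) : Fin (g + 1) ⊕ Fin (g + 1))

/-- The divisor `i w_0 + (r - i) v_{g+1}`. -/
def endsDivisor (L : ChainLengths g) (r i : ℕ) : L.graph.Divisor :=
  Finsupp.single L.leftEnd (i : ℤ) + Finsupp.single L.rightEnd ((r : ℤ) - i)

/-- `D'` is equivalent to `D`, and `D' - (i w_0 + (r - i) v_{g+1})` is effective. -/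
def IsEndsRep (L : ChainLengths g) (D : L.graph.Divisor) (r i : ℕ) (D' : L.graph.Divisor) : Prop :=
  MetricGraph.LinEquiv D D' ∧ 0 ≤ D' - L.endsDivisor r i

/-- `D` has rank `r` and its class is vertex avoiding: for every `0 ≤ i ≤ r` there is exactly one
divisor `D_i` equivalent to `D` of the form `D_i = i w_0 + (r - i) v_{g+1} + E_i` with `E_i`
effective, and the support of `E_i` contains no vertex of the chain. (In particular `D_i` has
multiplicity exactly `i` at `w_0` and exactly `r - i` at `v_{g+1}`.) -/
def IsVertexAvoiding (L : ChainLengths g) (D : L.graph.Divisor) (r : ℕ) : Prop :=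
  MetricGraph.HasRank D r ∧
    ∀ i : ℕ, i ≤ r → ∃ D' : L.graph.Divisor, L.IsEndsRep D r i D' ∧
      (∀ D'' : L.graph.Divisor, L.IsEndsRep D r i D'' → D'' = D') ∧
      ∀ v : L.graph.V, (D' - L.endsDivisor r i) (.vertex v) = 0

end ChainLengths

/-- The tropical maximal rank conjecture for the parameters `(g, r, d, m)`: on every chain of `g`
loops with admissible edge lengths there are a divisor `D` of rank `r` and degree `d` whose class is
vertex avoiding, with associated divisors `Di i ∼ D` for `0 ≤ i ≤ r`, and functions `ψ I` with
`m D + div (ψ I) = ∑ i ∈ I, Di i` for the multisets `I` of size `m` in `{0, …, r}`, such that some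
set `A` of `min (choose (r + m) m) (m d - g + 1)` of these functions is tropically independent.
The constant `C` says how much smaller `≪` has to mean; it depends on `g, r, d, m` only. -/
def TropicalMaximalRank (g r d m : ℕ) : Prop :=
  ∃ C : ℝ, 0 < C ∧ ∀ L : ChainLengths g, L.Admissible r (g + r - d) C →
    ∃ D : L.graph.Divisor, MetricGraph.deg D = d ∧ L.IsVertexAvoiding D r ∧
      ∃ Di : Fin (r + 1) → L.graph.Divisor, (∀ i : Fin (r + 1), L.IsEndsRep D r i (Di i)) ∧
      ∃ ψ : Sym (Fin (r + 1)) m → L.graph.Point → ℝ,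
        (∀ I, MetricGraph.IsDiv (ψ I) (((I : Multiset (Fin (r + 1))).map Di).sum - m • D)) ∧
      ∃ A : Finset (Sym (Fin (r + 1)) m),
        (A.card : ℤ) = min (((r + m).choose m : ℕ) : ℤ) ((m : ℤ) * d - g + 1) ∧
        ¬ TropicallyDependent A ψ

end

/-!
Take for `D` the canonical divisor, which has one chip at both ends of every inner bridge. The
Jacobian of a chain of loops is the product of its loops, so divisors of the same degree are
equivalent as soon as their positions on all the circles agree. Counting chips loop by loop shows
that `D` has rank `r = g - 1` and that `Dᵢ` is `i w₀ + (r - i) v_{g+1}` plus one chip on the top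
edge of every loop except the `i`-th: an effective divisor with too few chips misses a loop, and its
position there determines the number of chips to the right of it.

Independence is tested along the bridges. For `0 ≤ N ≤ r m` let `I_N` be the multiset of size `m`
and sum `N` whose elements differ by at most one. With suitable constants, `ψ_{I_N}` and
`ψ_{I_{N+1}}` cross exactly once, these crossings are evenly spaced in a uniform parametrization of
the bridges, and each `ψ_{I_N}` is the strict minimum between its two crossings. Replacing two equal
elements `j, j` of a multiset by `j - 1, j + 1` adds to the function a tent, rising along one bridge
and falling along the next, so that on either of them the new function can be translated to be the
strict minimum near a single crossing. All but one of the `r (m - 1)` crossings in the interior of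
a bridge allow such a replacement when `r ≥ 2`, which gives
`(r m + 1) + (r (m - 1) - 1) = 2 r m - r = m d - g + 1` independent functions.
-/

noncomputable section

open Filter Topology

namespace MetricGraph

/-! ### Piecewise linear functions on an interval -/

theorem IsIntegralPLOn.congr {φ χ : ℝ → ℝ} {a b : ℝ} (hφ : IsIntegralPLOn φ a b)
    (h : ∀ t ∈ Set.Icc a b, χ t = φ t) : IsIntegralPLOn χ a b := by
  obtain ⟨S, hS⟩ := hφ
  refine ⟨S, fun x y hx hxy hy hs => ?_⟩
  obtain ⟨k, hk⟩ := hS x y hx hxy hy hs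
  refine ⟨k, fun t ht => ?_⟩
  rw [h t ⟨hx.trans ht.1, ht.2.trans hy⟩, h x ⟨hx, hxy.trans hy⟩, hk t ht]

theorem isIntegralPLOn_affine (c : ℝ) (k : ℤ) (a b : ℝ) :
    IsIntegralPLOn (fun t => c + k * t) a b :=
  ⟨∅, fun x y _ _ _ _ => ⟨k, fun t _ => by ring⟩⟩

theorem isIntegralPLOn_zero (a b : ℝ) : IsIntegralPLOn (fun _ => 0) a b := by
  simpa using isIntegralPLOn_affine 0 0 a b

theorem isIntegralPLOn_hinge (n : ℤ) (s a b : ℝ) :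
    IsIntegralPLOn (fun t => n * max (t - s) 0) a b := by
  refine ⟨{s}, fun x y _ _ _ h => ?_⟩
  rcases le_or_gt s x with hs | hs
  · refine ⟨n, fun t ht => ?_⟩
    simp only [max_eq_left (sub_nonneg.2 hs), max_eq_left (sub_nonneg.2 (hs.trans ht.1))]
    ring
  · have hy : y ≤ s := not_lt.1 fun hy => h s (Finset.mem_singleton_self s) ⟨hs, hy⟩
    refine ⟨0, fun t ht => ?_⟩
    simp only [max_eq_right (sub_nonpos.2 hs.le), max_eq_right (sub_nonpos.2 (ht.2.trans hy))]
    ring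

theorem IsIntegralPLOn.add {φ χ : ℝ → ℝ} {a b : ℝ} (hφ : IsIntegralPLOn φ a b)
    (hχ : IsIntegralPLOn χ a b) : IsIntegralPLOn (φ + χ) a b := by
  classical
  obtain ⟨S, hS⟩ := hφ
  obtain ⟨T, hT⟩ := hχ
  refine ⟨S ∪ T, fun x y hx hxy hy h => ?_⟩
  obtain ⟨k, hk⟩ := hS x y hx hxy hy fun s hs => h s (Finset.mem_union_left _ hs)
  obtain ⟨l, hl⟩ := hT x y hx hxy hy fun s hs => h s (Finset.mem_union_right _ hs)
  refine ⟨k + l, fun t ht => ?_⟩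
  simp only [Pi.add_apply, hk t ht, hl t ht]
  push_cast
  ring

theorem IsIntegralPLOn.sum {ι : Type*} {s : Finset ι} {φ : ι → ℝ → ℝ} {a b : ℝ}
    (hφ : ∀ i ∈ s, IsIntegralPLOn (φ i) a b) : IsIntegralPLOn (∑ i ∈ s, φ i) a b :=
  Finset.sum_induction φ (IsIntegralPLOn · a b) (fun _ _ => .add) (isIntegralPLOn_zero a b) hφ

theorem exists_right_of_finset (S : Finset ℝ) {t b : ℝ} (h : t < b) :
    ∃ y, t < y ∧ y ≤ b ∧ ∀ s ∈ S, ¬ (t < s ∧ s < y) := by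
  have hS : ∀ᶠ y in 𝓝[>] t, ∀ s ∈ S, ¬ (t < s ∧ s < y) :=
    (eventually_all_finset S).2 fun s _ => by
      rcases le_or_gt s t with hs | hs
      · exact .of_forall fun y hy => hy.1.not_ge hs
      · filter_upwards [Ioo_mem_nhdsGT hs] with y hy hsy using hsy.2.not_gt hy.2
  obtain ⟨y, hyS, hty, hyb⟩ := (hS.and (Ioc_mem_nhdsGT h)).exists
  exact ⟨y, hty, hyb, hyS⟩

theorem exists_left_of_finset (S : Finset ℝ) {t a : ℝ} (h : a < t) :
    ∃ y, y < t ∧ a ≤ y ∧ ∀ s ∈ S, ¬ (y < s ∧ s < t) := by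
  have hS : ∀ᶠ y in 𝓝[<] t, ∀ s ∈ S, ¬ (y < s ∧ s < t) :=
    (eventually_all_finset S).2 fun s _ => by
      rcases le_or_gt t s with hs | hs
      · exact .of_forall fun y hy => hy.2.not_ge hs
      · filter_upwards [Ioo_mem_nhdsLT hs] with y hy hsy using hsy.1.not_gt hy.1
  obtain ⟨y, hyS, hay, hyt⟩ := (hS.and (Ico_mem_nhdsLT h)).exists
  exact ⟨y, hyt, hay, hyS⟩

theorem hasDerivWithinAt_Ici_of_affine {φ : ℝ → ℝ} {t y k : ℝ} (hy : t < y)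
    (h : ∀ u ∈ Set.Icc t y, φ u = φ t + k * (u - t)) : HasDerivWithinAt φ k (Set.Ici t) t := by
  have h0 : HasDerivWithinAt (fun u => φ t + k * (u - t)) k (Set.Ici t) t := by
    simpa using (((hasDerivAt_id t).sub_const t).const_mul k).const_add (φ t) |>.hasDerivWithinAt
  refine h0.congr_of_eventuallyEq ?_ (by simp)
  filter_upwards [Icc_mem_nhdsGE hy] with u hu using h u hu

theorem hasDerivWithinAt_Iic_of_affine {φ : ℝ → ℝ} {t y k : ℝ} (hy : y < t)
    (h : ∀ u ∈ Set.Icc y t, φ u = φ y + k * (u - y)) : HasDerivWithinAt φ k (Set.Iic t) t := by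
  have h0 : HasDerivWithinAt (fun u => φ y + k * (u - y)) k (Set.Iic t) t := by
    simpa using (((hasDerivAt_id t).sub_const y).const_mul k).const_add (φ y) |>.hasDerivWithinAt
  refine h0.congr_of_eventuallyEq ?_ (h t ⟨hy.le, le_rfl⟩)
  filter_upwards [Icc_mem_nhdsLE hy] with u hu using h u hu

theorem IsIntegralPLOn.exists_hasDerivWithinAt_Ici {φ : ℝ → ℝ} {a b t : ℝ}
    (hφ : IsIntegralPLOn φ a b) (ha : a ≤ t) (hb : t < b) :
    ∃ k : ℤ, HasDerivWithinAt φ k (Set.Ici t) t := by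
  obtain ⟨S, hS⟩ := hφ
  obtain ⟨y, hy, hyb, hyS⟩ := exists_right_of_finset S hb
  obtain ⟨k, hk⟩ := hS t y ha hy.le hyb hyS
  exact ⟨k, hasDerivWithinAt_Ici_of_affine hy hk⟩

theorem IsIntegralPLOn.exists_hasDerivWithinAt_Iic {φ : ℝ → ℝ} {a b t : ℝ}
    (hφ : IsIntegralPLOn φ a b) (ha : a < t) (hb : t ≤ b) :
    ∃ k : ℤ, HasDerivWithinAt φ k (Set.Iic t) t := by
  obtain ⟨S, hS⟩ := hφ
  obtain ⟨y, hy, hya, hyS⟩ := exists_left_of_finset S ha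
  obtain ⟨k, hk⟩ := hS y t hya hy.le hb hyS
  exact ⟨k, hasDerivWithinAt_Iic_of_affine hy hk⟩

theorem affine_of_affine_of_derivWithin_eq {φ : ℝ → ℝ} {x s y : ℝ} {k l : ℤ} (hxs : x < s)
    (hsy : s < y) (hk : ∀ t ∈ Set.Icc x s, φ t = φ x + k * (t - x))
    (hl : ∀ t ∈ Set.Icc s y, φ t = φ s + l * (t - s))
    (h : derivWithin φ (Set.Iic s) s = derivWithin φ (Set.Ici s) s) :
    ∀ t ∈ Set.Icc x y, φ t = φ x + k * (t - x) := by
  have hkl : (k : ℝ) = l := by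
    rwa [(hasDerivWithinAt_Iic_of_affine hxs hk).derivWithin (uniqueDiffWithinAt_Iic s),
      (hasDerivWithinAt_Ici_of_affine hsy hl).derivWithin (uniqueDiffWithinAt_Ici s)] at h
  intro t ht
  rcases le_total t s with hts | hts
  · exact hk t ⟨ht.1, hts⟩
  · rw [hl t ⟨hts, ht.2⟩, hk s ⟨hxs.le, le_rfl⟩, hkl]
    ring

theorem IsIntegralPLOn.affine_of_derivWithin_eq {φ : ℝ → ℝ} {a b : ℝ} (hab : a ≤ b)
    (hφ : IsIntegralPLOn φ a b)
    (h : ∀ t, a < t → t < b → derivWithin φ (Set.Iic t) t = derivWithin φ (Set.Ici t) t) :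
    ∃ k : ℤ, ∀ t ∈ Set.Icc a b, φ t = φ a + k * (t - a) := by
  classical
  obtain ⟨S, hS⟩ := hφ
  induction S using Finset.induction_on with
  | empty => exact hS a b le_rfl hab le_rfl (by simp)
  | insert s S _ ih =>
    refine ih fun x y hx hxy hy hxyS => ?_
    by_cases hs : x < s ∧ s < y
    · obtain ⟨k, hk⟩ := hS x s hx hs.1.le (hs.2.le.trans hy) <| Finset.forall_mem_insert _ _ _ |>.2
        ⟨fun hu => hu.2.false, fun u hu hu' => hxyS u hu ⟨hu'.1, hu'.2.trans hs.2⟩⟩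
      obtain ⟨l, hl⟩ := hS s y (hx.trans hs.1.le) hs.2.le hy <| Finset.forall_mem_insert _ _ _ |>.2
        ⟨fun hu => hu.1.false, fun u hu hu' => hxyS u hu ⟨hs.1.trans hu'.1, hu'.2⟩⟩
      exact ⟨k, affine_of_affine_of_derivWithin_eq hs.1 hs.2 hk hl
        (h s (hx.trans_lt hs.1) (hs.2.trans_le hy))⟩
    · exact hS x y hx hxy hy ((Finset.forall_mem_insert _ _ _).2 ⟨hs, hxyS⟩)

theorem hasDerivWithinAt_hinge_Ici (s t : ℝ) :
    HasDerivWithinAt (fun u => max (u - s) 0) (if s ≤ t then 1 else 0) (Set.Ici t) t := by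
  split_ifs with h
  · refine hasDerivWithinAt_Ici_of_affine (lt_add_one t) fun u hu => ?_
    rw [max_eq_left (sub_nonneg.2 h), max_eq_left (sub_nonneg.2 (h.trans hu.1))]
    ring
  · refine hasDerivWithinAt_Ici_of_affine (not_le.1 h) fun u hu => ?_
    rw [max_eq_right (sub_nonpos.2 (not_le.1 h).le), max_eq_right (sub_nonpos.2 hu.2)]
    ring

theorem hasDerivWithinAt_hinge_Iic (s t : ℝ) :
    HasDerivWithinAt (fun u => max (u - s) 0) (if s < t then 1 else 0) (Set.Iic t) t := by
  split_ifs with h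
  · refine hasDerivWithinAt_Iic_of_affine h fun u hu => ?_
    rw [max_eq_left (sub_nonneg.2 hu.1), sub_self, max_self]
    ring
  · have hts := not_lt.1 h
    refine hasDerivWithinAt_Iic_of_affine (sub_one_lt t) fun u hu => ?_
    rw [max_eq_right (sub_nonpos.2 (hu.2.trans hts)), max_eq_right (by linarith)]
    ring

/-! ### Pairing divisors with functions -/

variable {G : MetricGraph} {R : Type*} [CommRing R]

/-- The value at a divisor of the linear extension of a function `w` on the points of the graph:
the sum of the values of `w`, weighted by the coefficients of the divisor. Degrees, numbers of chips
in a region and the bend of a function with a given divisor are all of this form. -/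
def pairing (w : G.Point → R) : G.Divisor →+ R :=
  Finsupp.liftAddHom fun x => (AddMonoidHom.mulRight (w x)).comp (Int.castAddHom R)

theorem pairing_apply (w : G.Point → R) (F : G.Divisor) :
    pairing w F = F.sum fun x n => (n : R) * w x := rfl

@[simp] theorem pairing_single (w : G.Point → R) (x : G.Point) (n : ℤ) :
    pairing w (Finsupp.single x n) = n * w x := by
  simp [pairing]

theorem intCast_pairing (w : G.Point → ℤ) (F : G.Divisor) :
    ((pairing w F : ℤ) : R) = pairing (fun x => (w x : R)) F := by
  simp [pairing_apply, Finsupp.sum]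

theorem pairing_zero_left (F : G.Divisor) : pairing (fun _ => (0 : R)) F = 0 := by
  simp [pairing_apply]

theorem pairing_add_left (w w' : G.Point → R) (F : G.Divisor) :
    pairing (fun x => w x + w' x) F = pairing w F + pairing w' F := by
  simp [pairing_apply, Finsupp.sum, mul_add, Finset.sum_add_distrib]

theorem pairing_sub_left (w w' : G.Point → R) (F : G.Divisor) :
    pairing (fun x => w x - w' x) F = pairing w F - pairing w' F := by
  simp [pairing_apply, Finsupp.sum, mul_sub, Finset.sum_sub_distrib]

theorem pairing_mul_left (c : R) (w : G.Point → R) (F : G.Divisor) :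
    pairing (fun x => c * w x) F = c * pairing w F := by
  simp [pairing_apply, Finsupp.sum, Finset.mul_sum, mul_left_comm]

theorem pairing_sum_left {ι : Type*} (s : Finset ι) (w : ι → G.Point → R) (F : G.Divisor) :
    pairing (fun x => ∑ i ∈ s, w i x) F = ∑ i ∈ s, pairing (w i) F := by
  simp only [pairing_apply, Finsupp.sum, Finset.mul_sum]
  exact Finset.sum_comm

theorem pairing_congr {w w' : G.Point → R} {F : G.Divisor} (h : ∀ x, F x ≠ 0 → w x = w' x) :
    pairing w F = pairing w' F := by
  simp only [pairing_apply]
  exact Finsupp.sum_congr fun x hx => by rw [h x (Finsupp.mem_support_iff.1 hx)]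

theorem pairing_mono [PartialOrder R] [IsOrderedRing R] {w w' : G.Point → R} (h : ∀ x, w x ≤ w' x)
    {F : G.Divisor} (hF : 0 ≤ F) : pairing w F ≤ pairing w' F := by
  simp only [pairing_apply, Finsupp.sum]
  exact Finset.sum_le_sum fun x _ =>
    mul_le_mul_of_nonneg_left (h x) (Int.cast_nonneg (show (0 : ℤ) ≤ F x from hF x))

theorem pairing_pi_single [DecidableEq G.Point] (x : G.Point) (F : G.Divisor) :
    pairing (Pi.single x (1 : R)) F = F x := by
  simp +contextual [pairing_apply, Finsupp.sum, Pi.single_apply]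

theorem pairing_const_one (F : G.Divisor) : pairing (fun _ => (1 : ℤ)) F = deg F := by
  simp [pairing_apply, deg]

theorem deg_sub (F F' : G.Divisor) : deg (F - F') = deg F - deg F' := by
  simp only [← pairing_const_one, map_sub]

theorem deg_single (x : G.Point) (n : ℤ) : deg (Finsupp.single x n) = n := by
  simp [deg]

theorem deg_sum_single {ι : Type*} (s : Finset ι) (x : ι → G.Point) :
    deg (∑ k ∈ s, Finsupp.single (x k) 1) = s.card := by
  simp [← pairing_const_one]

/-- The number of chips of a divisor at the points with a given property. -/
def count (p : G.Point → Prop) [DecidablePred p] : G.Divisor →+ ℤ :=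
  pairing fun x => if p x then 1 else 0

section Count

variable {p q : G.Point → Prop} [DecidablePred p] [DecidablePred q] {F : G.Divisor}

theorem count_nonneg (hF : 0 ≤ F) : 0 ≤ count p F :=
  (pairing_zero_left F).symm.trans_le (pairing_mono (fun x => by positivity) hF)

theorem count_mono (h : ∀ x, p x → q x) (hF : 0 ≤ F) : count p F ≤ count q F := by
  refine pairing_mono (fun x => ?_) hF
  have := h x
  split_ifs <;> simp_all

theorem count_true (F : G.Divisor) : count (fun _ => True) F = deg F := by
  simp only [count, if_true, pairing_const_one]

theorem count_le_deg (hF : 0 ≤ F) : count p F ≤ deg F :=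
  (count_mono (fun _ _ => trivial) hF).trans_eq (count_true F)

theorem eq_zero_of_count_eq_zero (hF : 0 ≤ F) (h : count p F = 0) {x : G.Point} (hx : p x) :
    F x = 0 := by
  by_contra hne
  have hnonneg : ∀ y ∈ F.support, 0 ≤ F y * if p y then 1 else 0 := fun y _ =>
    mul_nonneg (hF y) (by positivity)
  have hzero := (Finset.sum_eq_zero_iff_of_nonneg hnonneg).1 h x (Finsupp.mem_support_iff.2 hne)
  exact hne (by simpa [hx] using hzero)

theorem exists_of_count_ne_zero (h : count p F ≠ 0) : ∃ x, p x ∧ F x ≠ 0 := by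
  by_contra! hF
  exact h ((pairing_congr (w' := fun _ => 0) fun x hx => if_neg fun hp => hx (hF x hp)).trans
    (pairing_zero_left F))

end Count

theorem eq_of_le_of_deg_eq {F F' : G.Divisor} (h : F ≤ F') (hd : deg F = deg F') : F = F' := by
  have hcount : count (fun _ => True) (F' - F) = 0 := by rw [count_true, deg_sub, hd, sub_self]
  refine (sub_eq_zero.1 (Finsupp.ext fun x => ?_)).symm
  exact eq_zero_of_count_eq_zero (sub_nonneg.2 h) hcount trivial

/-! ### The bend of a function along an edge -/

open Classical in
/-- The function on the points of the graph that is `φ` in the interior of the edge `e` and zero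
elsewhere. -/
def innerOn (e : G.E) (φ : ℝ → R) : G.Point → R
  | .vertex _ => 0
  | .inner e' t _ _ => if e' = e then φ t else 0

theorem innerOn_congr {e : G.E} {φ χ : ℝ → R} (h : ∀ t, 0 < t → t < G.len e → φ t = χ t) :
    (innerOn e φ : G.Point → R) = innerOn e χ := by
  funext x
  cases x with
  | vertex v => rfl
  | inner e' t h0 h1 =>
    simp only [innerOn]
    split_ifs with he
    · subst he
      exact h t h0 h1
    · rfl

theorem pairing_innerOn_zero (e : G.E) (F : G.Divisor) :
    pairing (innerOn e fun _ => (0 : R)) F = 0 := by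
  refine (pairing_congr fun x _ => ?_).trans (pairing_zero_left F)
  cases x <;> simp [innerOn]

theorem pairing_innerOn_sub (φ χ : ℝ → R) (e : G.E) (F : G.Divisor) :
    pairing (innerOn e fun t => φ t - χ t) F
      = pairing (innerOn e φ) F - pairing (innerOn e χ) F := by
  rw [← pairing_sub_left]
  congr 2
  funext x
  cases x <;> simp only [innerOn, sub_self]
  split_ifs <;> simp only [sub_self]

theorem pairing_innerOn_mul (c : R) (φ : ℝ → R) (e : G.E) (F : G.Divisor) :
    pairing (innerOn e fun t => c * φ t) F = c * pairing (innerOn e φ) F := by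
  rw [← pairing_mul_left]
  congr 2
  funext x
  cases x <;> simp [innerOn]

/-- The number of chips of a divisor in the interior of an edge. -/
def edgeDeg (e : G.E) : G.Divisor →+ ℤ := pairing (innerOn e fun _ => 1)

/-- The sum of the distances to the source of `e` of the chips of a divisor in the interior of
`e`. -/
def edgeMoment (e : G.E) : G.Divisor →+ ℝ := pairing (innerOn e fun t => t)

/-- The function on the edge `e` with value and slope zero at the source, whose slope increases by
the number of chips of the divisor at each interior point. -/
def bend (F : G.Divisor) (e : G.E) (t : ℝ) : ℝ := pairing (innerOn e fun a => max (t - a) 0) F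

theorem pairing_innerOn_const (c : R) (e : G.E) (F : G.Divisor) :
    pairing (innerOn e fun _ => c) F = c * edgeDeg e F := by
  have hone : pairing (innerOn e fun _ => (1 : R)) F = edgeDeg e F := by
    rw [edgeDeg, intCast_pairing]
    congr 2
    funext x
    cases x <;> simp [innerOn]
  simpa [hone] using pairing_innerOn_mul c (fun _ => 1) e F

theorem bend_zero (F : G.Divisor) (e : G.E) : bend F e 0 = 0 := by
  rw [bend, innerOn_congr (χ := fun _ => (0 : ℝ)) fun t h0 _ => by simpa using h0.le,
    pairing_innerOn_zero]

theorem bend_len (F : G.Divisor) (e : G.E) :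
    bend F e (G.len e) = G.len e * edgeDeg e F - edgeMoment e F := by
  rw [bend, innerOn_congr (χ := fun t => G.len e - t) (fun t _ h1 => by simpa using h1.le),
    pairing_innerOn_sub, pairing_innerOn_const, edgeMoment]

theorem bend_neg (F : G.Divisor) (e : G.E) (t : ℝ) : bend (-F) e t = -bend F e t :=
  map_neg _ F

theorem isIntegralPLOn_bend (F : G.Divisor) (e : G.E) (a b : ℝ) :
    IsIntegralPLOn (bend F e) a b := by
  have hbend : bend F e = ∑ x ∈ F.support, fun t => F x * innerOn e (fun a => max (t - a) 0) x := by
    funext t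
    simp [bend, pairing_apply, Finsupp.sum]
  rw [hbend]
  refine .sum fun x _ => ?_
  cases x with
  | vertex v => simpa [innerOn] using isIntegralPLOn_zero a b
  | inner e' s h0 h1 =>
    simp only [innerOn]
    split_ifs
    · exact isIntegralPLOn_hinge _ s a b
    · simpa using isIntegralPLOn_zero a b

theorem hasDerivWithinAt_pairing_innerOn {φ : ℝ → ℝ → ℝ} {φ' : ℝ → ℝ} {S : Set ℝ} {t : ℝ}
    (h : ∀ a, HasDerivWithinAt (fun u => φ u a) (φ' a) S t) (e : G.E) (F : G.Divisor) :
    HasDerivWithinAt (fun u => pairing (innerOn e (φ u)) F) (pairing (innerOn e φ') F) S t := by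
  simp only [pairing_apply, Finsupp.sum]
  refine HasDerivWithinAt.fun_sum fun x _ => HasDerivWithinAt.const_mul _ ?_
  cases x with
  | vertex v => exact hasDerivWithinAt_const t S 0
  | inner e' a h0 h1 =>
    simp only [innerOn]
    split_ifs
    · exact h a
    · exact hasDerivWithinAt_const t S 0

theorem hasDerivWithinAt_bend_Ici (F : G.Divisor) (e : G.E) (t : ℝ) :
    HasDerivWithinAt (bend F e) (pairing (innerOn e fun a => if a ≤ t then (1 : ℝ) else 0) F)
      (Set.Ici t) t :=
  hasDerivWithinAt_pairing_innerOn (fun a => hasDerivWithinAt_hinge_Ici a t) e F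

theorem hasDerivWithinAt_bend_Iic (F : G.Divisor) (e : G.E) (t : ℝ) :
    HasDerivWithinAt (bend F e) (pairing (innerOn e fun a => if a < t then (1 : ℝ) else 0) F)
      (Set.Iic t) t :=
  hasDerivWithinAt_pairing_innerOn (fun a => hasDerivWithinAt_hinge_Iic a t) e F

theorem pairing_innerOn_le_sub_lt (F : G.Divisor) (e : G.E) {t : ℝ} (h0 : 0 < t)
    (h1 : t < G.len e) :
    pairing (innerOn e fun a => if a ≤ t then (1 : ℝ) else 0) F
      - pairing (innerOn e fun a => if a < t then (1 : ℝ) else 0) F = F (.inner e t h0 h1) := by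
  classical
  rw [← pairing_pi_single (R := ℝ), ← pairing_innerOn_sub]
  congr 2
  funext x
  cases x with
  | vertex v => simp [innerOn]
  | inner e' s _ _ =>
    rw [Pi.single_apply]
    by_cases he : e' = e
    · subst he
      rcases lt_trichotomy s t with h | rfl | h
      · simp [innerOn, h, h.le, h.ne]
      · simp [innerOn]
      · simp [innerOn, h.not_gt, h.not_ge, h.ne']
    · simp [innerOn, he]

/-! ### The functions with a given divisor -/

theorem onEdge_inner (e : G.E) {t : ℝ} (h0 : 0 < t) (h1 : t < G.len e) :
    onEdge e t = .inner e t h0 h1 := by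
  simp [onEdge, h0, h1]

@[simp] theorem onEdge_zero (e : G.E) : onEdge e 0 = .vertex (G.src e) := by
  simp [onEdge]

@[simp] theorem onEdge_len (e : G.E) : onEdge e (G.len e) = .vertex (G.tgt e) := by
  simp [onEdge, (G.len_pos e).not_ge]

/-- On every edge `e`, the function `f` starts with the slope `k e` at the source of `e`, and then
bends as prescribed by the coefficients of `F` at the interior points of `e`. -/
def HasInitialSlopes (f : G.Point → ℝ) (F : G.Divisor) (k : G.E → ℤ) : Prop :=
  ∀ e, ∀ t ∈ Set.Icc 0 (G.len e), f (onEdge e t) = f (.vertex (G.src e)) + k e * t - bend F e t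

/-- The net flow into a vertex, for a flow with value `k e` at the source of `e`, of which the
coefficients of `F` are withdrawn at the interior points of `e`. -/
def netFlow (F : G.Divisor) (k : G.E → ℤ) (v : G.V) : ℤ :=
  ∑ e : G.E, ((if G.tgt e = v then k e - edgeDeg e F else 0) - (if G.src e = v then k e else 0))

/-- The flow with value `k e` at the source of `e` delivers the coefficients of `F` to the vertices
and to the interior points of the edges. -/
def IsFlow (F : G.Divisor) (k : G.E → ℤ) : Prop := ∀ v, F (.vertex v) = netFlow F k v

/-- The increment along an edge of a function with divisor `F` and initial slopes `k`. -/
def rise (F : G.Divisor) (k : G.E → ℤ) (e : G.E) : ℝ :=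
  (k e - edgeDeg e F : ℤ) * G.len e + edgeMoment e F

namespace HasInitialSlopes

variable {f : G.Point → ℝ} {F : G.Divisor} {k : G.E → ℤ}

theorem isPL (h : HasInitialSlopes f F k) : IsPL f := by
  intro e
  refine ((isIntegralPLOn_affine (f (.vertex (G.src e))) (k e) 0 (G.len e)).add
    (isIntegralPLOn_bend (-F) e 0 (G.len e))).congr fun t ht => ?_
  rw [h e t ht, Pi.add_apply, bend_neg, sub_eq_add_neg]

theorem slopeRight_eq (h : HasInitialSlopes f F k) (e : G.E) {t : ℝ} (h0 : 0 ≤ t)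
    (h1 : t < G.len e) :
    slopeRight f e t = k e - pairing (innerOn e fun a => if a ≤ t then (1 : ℝ) else 0) F := by
  have haffine :
      HasDerivWithinAt (fun t => f (.vertex (G.src e)) + k e * t) (k e) (Set.Ici t) t := by
    simpa using (((hasDerivAt_id t).const_mul (k e : ℝ)).const_add
      (f (.vertex (G.src e)))).hasDerivWithinAt
  refine ((haffine.sub (hasDerivWithinAt_bend_Ici F e t)).congr_of_eventuallyEq ?_
    (h e t ⟨h0, h1.le⟩)).derivWithin (uniqueDiffWithinAt_Ici t)
  filter_upwards [Icc_mem_nhdsGE h1] with u hu using h e u ⟨h0.trans hu.1, hu.2⟩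

theorem slopeLeft_eq (h : HasInitialSlopes f F k) (e : G.E) {t : ℝ} (h0 : 0 < t)
    (h1 : t ≤ G.len e) :
    slopeLeft f e t = k e - pairing (innerOn e fun a => if a < t then (1 : ℝ) else 0) F := by
  have haffine :
      HasDerivWithinAt (fun t => f (.vertex (G.src e)) + k e * t) (k e) (Set.Iic t) t := by
    simpa using (((hasDerivAt_id t).const_mul (k e : ℝ)).const_add
      (f (.vertex (G.src e)))).hasDerivWithinAt
  refine ((haffine.sub (hasDerivWithinAt_bend_Iic F e t)).congr_of_eventuallyEq ?_
    (h e t ⟨h0.le, h1⟩)).derivWithin (uniqueDiffWithinAt_Iic t)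
  filter_upwards [Icc_mem_nhdsLE h0] with u hu using h e u ⟨hu.1, hu.2.trans h1⟩

theorem slopeRight_zero (h : HasInitialSlopes f F k) (e : G.E) : slopeRight f e 0 = k e := by
  rw [h.slopeRight_eq e le_rfl (G.len_pos e),
    innerOn_congr (χ := fun _ => (0 : ℝ)) (fun t h0 _ => if_neg h0.not_ge),
    pairing_innerOn_zero, sub_zero]

theorem slopeLeft_len (h : HasInitialSlopes f F k) (e : G.E) :
    slopeLeft f e (G.len e) = (k e - edgeDeg e F : ℤ) := by
  rw [h.slopeLeft_eq e (G.len_pos e) le_rfl,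
    innerOn_congr (χ := fun _ => (1 : ℝ)) (fun t _ h1 => if_pos h1), pairing_innerOn_const,
    one_mul, Int.cast_sub]

theorem ord_inner (h : HasInitialSlopes f F k) (e : G.E) {t : ℝ} (h0 : 0 < t)
    (h1 : t < G.len e) : ord f (.inner e t h0 h1) = F (.inner e t h0 h1) := by
  rw [ord, h.slopeLeft_eq e h0 h1.le, h.slopeRight_eq e h0.le h1,
    ← pairing_innerOn_le_sub_lt F e h0 h1]
  ring

theorem ord_vertex (h : HasInitialSlopes f F k) (v : G.V) :
    ord f (.vertex v) = netFlow F k v := by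
  simp only [ord, netFlow, Int.cast_sum, h.slopeRight_zero, h.slopeLeft_len]
  push_cast
  rfl

theorem isDiv (h : HasInitialSlopes f F k) (hF : IsFlow F k) : IsDiv f F := by
  refine ⟨h.isPL, fun p => ?_⟩
  cases p with
  | vertex v => rw [h.ord_vertex, hF]
  | inner e t h0 h1 => exact h.ord_inner e h0 h1

theorem rise_eq_sub (h : HasInitialSlopes f F k) (e : G.E) :
    rise F k e = f (.vertex (G.tgt e)) - f (.vertex (G.src e)) := by
  have hlen := h e (G.len e) ⟨(G.len_pos e).le, le_rfl⟩
  rw [onEdge_len, bend_len] at hlen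
  rw [hlen, rise]
  push_cast
  ring

end HasInitialSlopes

theorem IsDiv.derivWithin_add_bend_eq {f : G.Point → ℝ} {F : G.Divisor} (h : IsDiv f F) (e : G.E)
    {t : ℝ} (h0 : 0 < t) (h1 : t < G.len e) :
    derivWithin ((fun t => f (onEdge e t)) + bend F e) (Set.Iic t) t
      = derivWithin ((fun t => f (onEdge e t)) + bend F e) (Set.Ici t) t := by
  obtain ⟨l, hl⟩ := (h.1 e).exists_hasDerivWithinAt_Iic h0 h1.le
  obtain ⟨l', hl'⟩ := (h.1 e).exists_hasDerivWithinAt_Ici h0.le h1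
  have hord : (l : ℝ) - l' = F (.inner e t h0 h1) := by
    rw [← h.2, ord, slopeLeft, slopeRight, hl.derivWithin (uniqueDiffWithinAt_Iic t),
      hl'.derivWithin (uniqueDiffWithinAt_Ici t)]
  rw [(hl.add (hasDerivWithinAt_bend_Iic F e t)).derivWithin (uniqueDiffWithinAt_Iic t),
    (hl'.add (hasDerivWithinAt_bend_Ici F e t)).derivWithin (uniqueDiffWithinAt_Ici t)]
  linarith [pairing_innerOn_le_sub_lt F e h0 h1]

theorem IsDiv.exists_hasInitialSlopes {f : G.Point → ℝ} {F : G.Divisor} (h : IsDiv f F) :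
    ∃ k, HasInitialSlopes f F k := by
  have haffine : ∀ e, ∃ k : ℤ, ∀ t ∈ Set.Icc 0 (G.len e),
      f (onEdge e t) = f (.vertex (G.src e)) + k * t - bend F e t := by
    intro e
    obtain ⟨k, hk⟩ := ((h.1 e).add (isIntegralPLOn_bend F e _ _)).affine_of_derivWithin_eq
      (G.len_pos e).le fun t h0 h1 => h.derivWithin_add_bend_eq e h0 h1
    refine ⟨k, fun t ht => ?_⟩
    have hkt := hk t ht
    simp only [Pi.add_apply, onEdge_zero, bend_zero] at hkt
    linarith
  choose k hk using haffine
  exact ⟨k, hk⟩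

theorem IsDiv.isFlow {f : G.Point → ℝ} {F : G.Divisor} {k : G.E → ℤ} (h : IsDiv f F)
    (hk : HasInitialSlopes f F k) : IsFlow F k := fun v => by
  exact_mod_cast (h.2 (.vertex v)).symm.trans (hk.ord_vertex v)

theorem exists_isDiv_of_potential {F : G.Divisor} {k : G.E → ℤ} {P : G.V → ℝ}
    (hP : ∀ e, P (G.tgt e) = P (G.src e) + rise F k e) (hF : IsFlow F k) :
    ∃ f : G.Point → ℝ, IsDiv f F ∧ HasInitialSlopes f F k ∧ ∀ v, f (.vertex v) = P v := by
  let f : G.Point → ℝ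
    | .vertex v => P v
    | .inner e t _ _ => P (G.src e) + k e * t - bend F e t
  have hf : HasInitialSlopes f F k := by
    intro e t ht
    rcases ht.1.eq_or_lt with rfl | h0
    · simp [bend_zero]
    rcases ht.2.eq_or_lt with rfl | h1
    · rw [onEdge_len, bend_len]
      change P (G.tgt e) = P (G.src e) + _ - _
      rw [hP, rise]
      push_cast
      ring
    · rw [onEdge_inner e h0 h1]
  exact ⟨f, hf.isDiv hF, hf, fun _ => rfl⟩

theorem rise_add (F F' : G.Divisor) (k k' : G.E → ℤ) (e : G.E) :
    rise (F + F') (k + k') e = rise F k e + rise F' k' e := by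
  simp only [rise, map_add, Pi.add_apply]
  push_cast
  ring

theorem netFlow_add (F F' : G.Divisor) (k k' : G.E → ℤ) (v : G.V) :
    netFlow (F + F') (k + k') v = netFlow F k v + netFlow F' k' v := by
  simp only [netFlow, map_add, Pi.add_apply, ← Finset.sum_add_distrib]
  refine Finset.sum_congr rfl fun e _ => ?_
  split_ifs <;> ring

theorem isFlow_zero : IsFlow (0 : G.Divisor) 0 := fun v => by simp [netFlow]

theorem IsFlow.add {F F' : G.Divisor} {k k' : G.E → ℤ} (h : IsFlow F k) (h' : IsFlow F' k') :
    IsFlow (F + F') (k + k') := fun v => by rw [netFlow_add, ← h, ← h', Finsupp.add_apply]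

theorem rise_multiset_sum {ι : Type*} (F : ι → G.Divisor) (k : ι → G.E → ℤ) (I : Multiset ι)
    (e : G.E) : rise (I.map F).sum (I.map k).sum e = (I.map fun i => rise (F i) (k i) e).sum := by
  induction I using Multiset.induction_on with
  | empty => simp [rise]
  | cons i I ih => simp only [Multiset.map_cons, Multiset.sum_cons, rise_add, ih]

/-! ### Summation by parts -/

theorem pairing_eq_sum [Fintype G.V] (w : G.Point → R) (F : G.Divisor) :
    pairing w F = ∑ v, F (.vertex v) * w (.vertex v)
      + ∑ e, pairing (innerOn e fun t => w (onEdge e t)) F := by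
  induction F using Finsupp.induction_linear with
  | zero => simp
  | add F F' h h' =>
    simp only [map_add, Finsupp.add_apply, Int.cast_add, add_mul, Finset.sum_add_distrib, h, h']
    ring
  | single x n =>
    classical
    cases x with
    | vertex v => simp [innerOn, Finsupp.single_apply]
    | inner e s h0 h1 => simp [innerOn, onEdge_inner e h0 h1]

theorem sum_netFlow_mul [Fintype G.V] (F : G.Divisor) (k : G.E → ℤ) (u : G.V → R) :
    ∑ v, (netFlow F k v : R) * u v =
      ∑ e, ((k e - edgeDeg e F : ℤ) * u (G.tgt e) - k e * u (G.src e)) := by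
  simp only [netFlow, Int.cast_sum, Finset.sum_mul]
  rw [Finset.sum_comm]
  refine Finset.sum_congr rfl fun e _ => ?_
  simp [sub_mul, Finset.sum_sub_distrib, ite_mul]

theorem IsFlow.pairing_eq [Finite G.V] {F : G.Divisor} {k : G.E → ℤ} (h : IsFlow F k)
    (w : G.Point → R) : pairing w F = ∑ e, ((k e - edgeDeg e F : ℤ) * w (.vertex (G.tgt e))
      - k e * w (.vertex (G.src e)) + pairing (innerOn e fun t => w (onEdge e t)) F) := by
  cases nonempty_fintype G.V
  rw [pairing_eq_sum, Finset.sum_add_distrib, ← sum_netFlow_mul F k fun v => w (.vertex v)]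
  simp only [h _]

theorem IsFlow.deg_eq_zero [Finite G.V] {F : G.Divisor} {k : G.E → ℤ} (h : IsFlow F k) :
    deg F = 0 := by
  rw [← pairing_const_one, h.pairing_eq]
  refine Finset.sum_eq_zero fun e _ => ?_
  rw [pairing_innerOn_const]
  simp

theorem isFlow_of_forall_ne [Finite G.V] {F : G.Divisor} {k : G.E → ℤ} (hdeg : deg F = 0)
    {v₀ : G.V} (h : ∀ v, v ≠ v₀ → F (.vertex v) = netFlow F k v) : IsFlow F k := by
  cases nonempty_fintype G.V
  have hF : ∑ v, F (.vertex v) + ∑ e, edgeDeg e F = 0 := by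
    rw [← hdeg, ← pairing_const_one, pairing_eq_sum]
    simp [edgeDeg]
  have hk : ∑ v, netFlow F k v + ∑ e, edgeDeg e F = 0 := by
    simpa [eq_neg_iff_add_eq_zero] using sum_netFlow_mul F k fun _ => (1 : ℤ)
  have hsum : ∑ v, (F (.vertex v) - netFlow F k v) = 0 := by
    rw [Finset.sum_sub_distrib]
    linarith
  rw [Fintype.sum_eq_single v₀ fun v hv => sub_eq_zero.2 (h v hv)] at hsum
  intro v
  rcases eq_or_ne v v₀ with rfl | hv
  · exact sub_eq_zero.1 hsum
  · exact h v hv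

end MetricGraph

namespace ChainLengths

open MetricGraph

variable {g : ℕ} (L : ChainLengths g)

/-! ### The chain of loops -/

/-- The bridge from `w_j` to `v_{j+1}`. -/
def bridge (j : Fin (g + 1)) : L.graph.E := (Sum.inl j : Fin (g + 1) ⊕ (Fin g ⊕ Fin g))

/-- The top edge of the loop from `v_{k+1}` to `w_{k+1}`. -/
def top (k : Fin g) : L.graph.E := (Sum.inr (Sum.inl k) : Fin (g + 1) ⊕ (Fin g ⊕ Fin g))

/-- The bottom edge of the loop from `v_{k+1}` to `w_{k+1}`. -/
def bot (k : Fin g) : L.graph.E := (Sum.inr (Sum.inr k) : Fin (g + 1) ⊕ (Fin g ⊕ Fin g))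

/-- The vertex `w_j`, the source of the bridge `j`. -/
def bridgeSrc (j : Fin (g + 1)) : L.graph.V := (Sum.inl j : Fin (g + 1) ⊕ Fin (g + 1))

/-- The vertex `v_{j+1}`, the target of the bridge `j`. -/
def bridgeTgt (j : Fin (g + 1)) : L.graph.V := (Sum.inr j : Fin (g + 1) ⊕ Fin (g + 1))

instance : Fintype L.graph.V := inferInstanceAs (Fintype (Fin (g + 1) ⊕ Fin (g + 1)))

@[simp] theorem src_bridge (j : Fin (g + 1)) : L.graph.src (L.bridge j) = L.bridgeSrc j := rfl
@[simp] theorem tgt_bridge (j : Fin (g + 1)) : L.graph.tgt (L.bridge j) = L.bridgeTgt j := rfl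
@[simp] theorem src_top (k : Fin g) : L.graph.src (L.top k) = L.bridgeTgt k.castSucc := rfl
@[simp] theorem tgt_top (k : Fin g) : L.graph.tgt (L.top k) = L.bridgeSrc k.succ := rfl
@[simp] theorem src_bot (k : Fin g) : L.graph.src (L.bot k) = L.bridgeTgt k.castSucc := rfl
@[simp] theorem tgt_bot (k : Fin g) : L.graph.tgt (L.bot k) = L.bridgeSrc k.succ := rfl
@[simp] theorem len_bridge (j : Fin (g + 1)) : L.graph.len (L.bridge j) = L.n j := rfl
@[simp] theorem len_top (k : Fin g) : L.graph.len (L.top k) = L.ℓ (k + 1) := rfl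
@[simp] theorem len_bot (k : Fin g) : L.graph.len (L.bot k) = L.m (k + 1) := rfl

@[simp] theorem bridgeSrc_inj {i j : Fin (g + 1)} : L.bridgeSrc i = L.bridgeSrc j ↔ i = j :=
  Sum.inl_injective.eq_iff

@[simp] theorem bridgeTgt_inj {i j : Fin (g + 1)} : L.bridgeTgt i = L.bridgeTgt j ↔ i = j :=
  Sum.inr_injective.eq_iff

@[simp] theorem bridgeSrc_ne_bridgeTgt (i j : Fin (g + 1)) : L.bridgeSrc i ≠ L.bridgeTgt j :=
  Sum.inl_ne_inr

@[simp] theorem bridgeTgt_ne_bridgeSrc (i j : Fin (g + 1)) : L.bridgeTgt i ≠ L.bridgeSrc j :=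
  Sum.inr_ne_inl

theorem forall_vertex {p : L.graph.V → Prop} :
    (∀ v, p v) ↔ (∀ j, p (L.bridgeSrc j)) ∧ ∀ j, p (L.bridgeTgt j) :=
  Sum.forall

theorem forall_edge {p : L.graph.E → Prop} :
    (∀ e, p e) ↔ (∀ j, p (L.bridge j)) ∧ (∀ k, p (L.top k)) ∧ ∀ k, p (L.bot k) :=
  Sum.forall.trans (and_congr Iff.rfl Sum.forall)

theorem sum_edges {M : Type*} [AddCommMonoid M] (f : L.graph.E → M) :
    ∑ e, f e = ∑ j, f (L.bridge j) + (∑ k, f (L.top k) + ∑ k, f (L.bot k)) :=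
  (Fintype.sum_sum_type f).trans
    (congrArg _ (Fintype.sum_sum_type (fun x : Fin g ⊕ Fin g => f (Sum.inr x))))

variable {L}

section NetFlow

variable (F : L.graph.Divisor) (k : L.graph.E → ℤ)

theorem netFlow_bridgeSrc_zero : netFlow F k (L.bridgeSrc 0) = - k (L.bridge 0) := by
  simp [netFlow, sum_edges, Fin.succ_ne_zero]

theorem netFlow_bridgeSrc_succ (i : Fin g) : netFlow F k (L.bridgeSrc i.succ) =
    (k (L.top i) - edgeDeg (L.top i) F) + (k (L.bot i) - edgeDeg (L.bot i) F)
      - k (L.bridge i.succ) := by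
  simp [netFlow, sum_edges]

theorem netFlow_bridgeTgt_castSucc (i : Fin g) : netFlow F k (L.bridgeTgt i.castSucc) =
    k (L.bridge i.castSucc) - edgeDeg (L.bridge i.castSucc) F - (k (L.top i) + k (L.bot i)) := by
  simp [netFlow, sum_edges, sub_eq_add_neg, add_comm]

theorem netFlow_bridgeTgt_last : netFlow F k (L.bridgeTgt (Fin.last g)) =
    k (L.bridge (Fin.last g)) - edgeDeg (L.bridge (Fin.last g)) F := by
  simp [netFlow, sum_edges, Fin.castSucc_ne_last]

end NetFlow

variable (L) in
/-- The initial slopes on the edges of a function with divisor `F`: as the loops are the only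
cycles, a flow integrates to a function once it has the same rise on both edges of every loop. -/
structure IsPotentialFlow (F : L.graph.Divisor) (k : L.graph.E → ℤ) : Prop where
  isFlow : IsFlow F k
  rise_top : ∀ i, rise F k (L.top i) = rise F k (L.bot i)

namespace IsPotentialFlow

variable {F F' : L.graph.Divisor} {k k' : L.graph.E → ℤ}

theorem exists_isDiv (h : L.IsPotentialFlow F k) :
    ∃ f : L.graph.Point → ℝ, IsDiv f F ∧ HasInitialSlopes f F k ∧ f L.leftEnd = 0 := by
  let P : Fin (g + 1) → ℝ := Fin.induction (motive := fun _ => ℝ) 0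
    fun i x => x + rise F k (L.bridge i.castSucc) + rise F k (L.bot i)
  have hP (i : Fin g) : P i.succ =
      P i.castSucc + rise F k (L.bridge i.castSucc) + rise F k (L.bot i) := Fin.induction_succ ..
  obtain ⟨f, hf, hk, hfP⟩ := exists_isDiv_of_potential (F := F) (k := k)
    (P := Sum.elim P fun j => P j + rise F k (L.bridge j))
    (L.forall_edge.2 ⟨fun _ => rfl, fun i => by rw [h.rise_top]; exact hP i, hP⟩) h.isFlow
  exact ⟨f, hf, hk, hfP (L.bridgeSrc 0)⟩

theorem add (h : L.IsPotentialFlow F k) (h' : L.IsPotentialFlow F' k') :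
    L.IsPotentialFlow (F + F') (k + k') where
  isFlow := h.isFlow.add h'.isFlow
  rise_top i := by rw [rise_add, rise_add, h.rise_top, h'.rise_top]

theorem multiset_sum {ι : Type*} {F : ι → L.graph.Divisor} {k : ι → L.graph.E → ℤ}
    (h : ∀ i, L.IsPotentialFlow (F i) (k i)) (I : Multiset ι) :
    L.IsPotentialFlow (I.map F).sum (I.map k).sum := by
  induction I using Multiset.induction_on with
  | empty => exact ⟨isFlow_zero, fun i => by simp [rise]⟩
  | cons i I ih => simpa only [Multiset.map_cons, Multiset.sum_cons] using (h i).add ih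

end IsPotentialFlow

/-! ### Linear equivalence on a chain of loops -/

/-- The position of a point along the chain: `2 j` on the bridge `j` and `2 k + 1` in the interior
of an edge of the loop `k`. -/
def level : L.graph.Point → ℕ
  | .vertex v => 2 * Sum.elim Fin.val Fin.val v
  | .inner e _ _ _ => Sum.elim (fun j : Fin (g + 1) => 2 * j.val)
      (Sum.elim (fun k : Fin g => 2 * k.val + 1) (fun k : Fin g => 2 * k.val + 1)) e

/-- The coordinate on a loop in which the bottom edge is traversed forwards and the top edge
backwards. -/
def coord : L.graph.Point → ℝ
  | .vertex _ => 0
  | .inner e t _ _ => Sum.elim (fun _ : Fin (g + 1) => 0)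
      (Sum.elim (fun _ : Fin g => -t) (fun _ : Fin g => t)) e

/-- The retraction of the chain onto the loop `k`, in the coordinate `coord`. -/
def pos (k : Fin g) (x : L.graph.Point) : ℝ :=
  if level x < 2 * k + 1 then 0 else if 2 * k + 1 < level x then L.m (k + 1) else coord x

@[simp] theorem level_bridgeSrc (j : Fin (g + 1)) :
    level (.vertex (L.bridgeSrc j)) = 2 * j := rfl
@[simp] theorem level_bridgeTgt (j : Fin (g + 1)) :
    level (.vertex (L.bridgeTgt j)) = 2 * j := rfl
@[simp] theorem level_inner_bridge (j : Fin (g + 1)) (t : ℝ) (h0 : 0 < t)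
    (h1 : t < L.graph.len (L.bridge j)) : level (.inner (L.bridge j) t h0 h1) = 2 * j := rfl
@[simp] theorem level_inner_top (k : Fin g) (t : ℝ) (h0 : 0 < t)
    (h1 : t < L.graph.len (L.top k)) : level (.inner (L.top k) t h0 h1) = 2 * k + 1 := rfl
@[simp] theorem level_inner_bot (k : Fin g) (t : ℝ) (h0 : 0 < t)
    (h1 : t < L.graph.len (L.bot k)) : level (.inner (L.bot k) t h0 h1) = 2 * k + 1 := rfl
@[simp] theorem coord_inner_top (k : Fin g) (t : ℝ) (h0 : 0 < t)
    (h1 : t < L.graph.len (L.top k)) : coord (.inner (L.top k) t h0 h1) = -t := rfl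
@[simp] theorem coord_inner_bot (k : Fin g) (t : ℝ) (h0 : 0 < t)
    (h1 : t < L.graph.len (L.bot k)) : coord (.inner (L.bot k) t h0 h1) = t := rfl

section Pos

variable {k : Fin g} {x y : L.graph.Point}

theorem pos_of_level_lt (h : level x < 2 * k + 1) : pos k x = 0 := if_pos h

theorem pos_of_lt_level (h : 2 * k + 1 < level x) : pos k x = L.m (k + 1) := by
  rw [pos, if_neg h.not_gt, if_pos h]

theorem pos_of_level_eq (h : level x = 2 * k + 1) : pos k x = coord x := by
  rw [pos, if_neg h.not_lt, if_neg h.not_gt]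

theorem pos_bridgeTgt_castSucc (k : Fin g) :
    pos k (.vertex (L.bridgeTgt k.castSucc)) = 0 :=
  pos_of_level_lt (by simp)

theorem pos_bridgeSrc_succ (k : Fin g) :
    pos k (.vertex (L.bridgeSrc k.succ)) = L.m (k + 1) :=
  pos_of_lt_level (by simp only [level_bridgeSrc, Fin.val_succ]; omega)

theorem pos_leftEnd (k : Fin g) : pos k L.leftEnd = 0 :=
  pos_of_level_lt (x := .vertex (L.bridgeSrc 0)) (by simp)

theorem pos_rightEnd (k : Fin g) : pos k L.rightEnd = L.m (k + 1) :=
  pos_of_lt_level (x := .vertex (L.bridgeTgt (Fin.last g)))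
    (by simp only [level_bridgeTgt, Fin.val_last]; omega)

end Pos

/-- The contribution of the edge `e` to `pairing w F`, for a flow `s` with divisor `F`. -/
def edgeTerm (w : L.graph.Point → ℝ) (F : L.graph.Divisor) (s : L.graph.E → ℤ)
    (e : L.graph.E) : ℝ :=
  (s e - edgeDeg e F : ℤ) * w (.vertex (L.graph.tgt e)) - s e * w (.vertex (L.graph.src e))
    + pairing (innerOn e fun t => w (onEdge e t)) F

section EdgeTerm

variable {w : L.graph.Point → ℝ} {F : L.graph.Divisor} {s : L.graph.E → ℤ}

theorem edgeTerm_eq_zero_of_const {e : L.graph.E} {c : ℝ}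
    (hsrc : w (.vertex (L.graph.src e)) = c) (htgt : w (.vertex (L.graph.tgt e)) = c)
    (h : ∀ t h0 h1, w (.inner e t h0 h1) = c) : edgeTerm w F s e = 0 := by
  rw [edgeTerm, innerOn_congr (χ := fun _ => c) (fun t h0 h1 => by rw [onEdge_inner e h0 h1, h]),
    pairing_innerOn_const, hsrc, htgt]
  push_cast
  ring

theorem edgeTerm_bridge_pos (j : Fin (g + 1)) (k : Fin g) :
    edgeTerm (pos k) F s (L.bridge j) = 0 := by
  rcases lt_or_ge (k : ℕ) j with h | h
  · have hj : 2 * (k : ℕ) + 1 < 2 * j := by omega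
    exact edgeTerm_eq_zero_of_const (pos_of_lt_level hj) (pos_of_lt_level hj)
      fun _ _ _ => pos_of_lt_level hj
  · have hj : 2 * (j : ℕ) < 2 * k + 1 := by omega
    exact edgeTerm_eq_zero_of_const (pos_of_level_lt hj) (pos_of_level_lt hj)
      fun _ _ _ => pos_of_level_lt hj

theorem edgeTerm_pos_of_ne {e : L.graph.E} {i k : Fin g} (hik : i ≠ k)
    (hsrc : level (.vertex (L.graph.src e)) = 2 * i)
    (htgt : level (.vertex (L.graph.tgt e)) = 2 * i + 2)
    (h : ∀ t h0 h1, level (.inner e t h0 h1) = 2 * i + 1) : edgeTerm (pos k) F s e = 0 := by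
  rcases lt_or_gt_of_ne (Fin.val_ne_of_ne hik) with hlt | hlt
  · exact edgeTerm_eq_zero_of_const (pos_of_level_lt (by omega)) (pos_of_level_lt (by omega))
      fun t h0 h1 => pos_of_level_lt (by rw [h]; omega)
  · exact edgeTerm_eq_zero_of_const (pos_of_lt_level (by omega)) (pos_of_lt_level (by omega))
      fun t h0 h1 => pos_of_lt_level (by rw [h]; omega)

theorem edgeTerm_top_pos (k : Fin g) : edgeTerm (pos k) F s (L.top k)
    = (s (L.top k) - edgeDeg (L.top k) F : ℤ) * (L.ℓ (k + 1) + L.m (k + 1))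
      - rise F s (L.top k) := by
  rw [edgeTerm, innerOn_congr (χ := fun t => -1 * t) (fun t h0 h1 => by
      rw [onEdge_inner _ h0 h1, pos_of_level_eq (by simp), coord_inner_top, neg_one_mul]),
    pairing_innerOn_mul, tgt_top, src_top, pos_bridgeSrc_succ, pos_bridgeTgt_castSucc, rise,
    edgeMoment, len_top]
  ring

theorem edgeTerm_bot_pos (k : Fin g) :
    edgeTerm (pos k) F s (L.bot k) = rise F s (L.bot k) := by
  rw [edgeTerm, innerOn_congr (χ := fun t => t) (fun t h0 h1 => by
      rw [onEdge_inner _ h0 h1, pos_of_level_eq (by simp), coord_inner_bot]),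
    tgt_bot, src_bot, pos_bridgeSrc_succ, pos_bridgeTgt_castSucc, rise, edgeMoment, len_bot]
  ring

theorem pairing_pos_eq (h : IsFlow F s) (k : Fin g) :
    pairing (pos k) F = (s (L.top k) - edgeDeg (L.top k) F : ℤ) * (L.ℓ (k + 1) + L.m (k + 1))
      + rise F s (L.bot k) - rise F s (L.top k) := by
  have hsum : pairing (pos k) F = ∑ e, edgeTerm (pos k) F s e := h.pairing_eq _
  rw [hsum, sum_edges, Finset.sum_eq_zero fun j _ => edgeTerm_bridge_pos j k,
    Fintype.sum_eq_single k fun i hi => edgeTerm_pos_of_ne hi rfl rfl fun _ _ _ => rfl,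
    Fintype.sum_eq_single k fun i hi => edgeTerm_pos_of_ne hi rfl rfl fun _ _ _ => rfl,
    edgeTerm_top_pos, edgeTerm_bot_pos]
  ring

end EdgeTerm

section Flow

variable (F : L.graph.Divisor) (t : Fin g → ℤ)

/-- The slope at `w_j` along the bridge `j` of a function with divisor `F`: the flow through a
bridge is determined by the coefficients of `F` to the left of it. -/
def bridgeSlope : Fin (g + 1) → ℤ :=
  Fin.induction (-F (.vertex (L.bridgeSrc 0))) fun i x =>
    x - edgeDeg (L.bridge i.castSucc) F - F (.vertex (L.bridgeTgt i.castSucc))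
      - edgeDeg (L.top i) F - edgeDeg (L.bot i) F - F (.vertex (L.bridgeSrc i.succ))

/-- The flow with divisor `F` and with the value `t i` at the source of the top edge of the loop
`i`. -/
def flowOfTops : L.graph.E → ℤ :=
  Sum.elim (bridgeSlope F) (Sum.elim t fun i => bridgeSlope F i.castSucc
    - edgeDeg (L.bridge i.castSucc) F - F (.vertex (L.bridgeTgt i.castSucc)) - t i)

theorem bridgeSlope_zero : bridgeSlope F 0 = -F (.vertex (L.bridgeSrc 0)) := rfl

theorem bridgeSlope_succ (i : Fin g) : bridgeSlope F i.succ = bridgeSlope F i.castSucc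
    - edgeDeg (L.bridge i.castSucc) F - F (.vertex (L.bridgeTgt i.castSucc))
    - edgeDeg (L.top i) F - edgeDeg (L.bot i) F - F (.vertex (L.bridgeSrc i.succ)) :=
  Fin.induction_succ ..

theorem flowOfTops_bridge (j : Fin (g + 1)) : flowOfTops F t (L.bridge j) = bridgeSlope F j := rfl

theorem flowOfTops_top (i : Fin g) : flowOfTops F t (L.top i) = t i := rfl

theorem flowOfTops_bot (i : Fin g) : flowOfTops F t (L.bot i) = bridgeSlope F i.castSucc
    - edgeDeg (L.bridge i.castSucc) F - F (.vertex (L.bridgeTgt i.castSucc)) - t i := rfl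

variable {F}

theorem isFlow_flowOfTops (hdeg : deg F = 0) : IsFlow F (flowOfTops F t) := by
  refine isFlow_of_forall_ne hdeg (v₀ := L.bridgeTgt (Fin.last g)) (L.forall_vertex.2
    ⟨fun j _ => ?_, fun j => Fin.lastCases (fun h => absurd rfl h) (fun i _ => ?_) j⟩)
  · refine Fin.cases ?_ (fun i => ?_) j
    · rw [netFlow_bridgeSrc_zero, flowOfTops_bridge, bridgeSlope_zero, neg_neg]
    · rw [netFlow_bridgeSrc_succ, flowOfTops_bridge, flowOfTops_top, flowOfTops_bot,
        bridgeSlope_succ]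
      ring
  · rw [netFlow_bridgeTgt_castSucc, flowOfTops_bridge, flowOfTops_top, flowOfTops_bot]
    ring

end Flow

/-- Linear equivalence amounts to equality in the Jacobian, which is the product of the loops. -/
theorem linEquiv_iff (D D' : L.graph.Divisor) : LinEquiv D D' ↔ deg D' = deg D ∧
    ∀ k : Fin g, ∃ z : ℤ,
      pairing (pos k) D' = pairing (pos k) D + z * (L.ℓ (k + 1) + L.m (k + 1)) := by
  rw [← sub_eq_zero (a := deg D'), ← deg_sub]
  constructor
  · rintro ⟨f, hf⟩
    obtain ⟨s, hs⟩ := hf.exists_hasInitialSlopes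
    refine ⟨(hf.isFlow hs).deg_eq_zero, fun k => ⟨s (L.top k) - edgeDeg (L.top k) (D' - D), ?_⟩⟩
    have hpos := pairing_pos_eq (hf.isFlow hs) k
    rw [hs.rise_eq_sub, hs.rise_eq_sub, map_sub, tgt_top, tgt_bot, src_top, src_bot] at hpos
    linarith
  · rintro ⟨hdeg, hz⟩
    choose z hz using hz
    let t (i : Fin g) : ℤ := z i + edgeDeg (L.top i) (D' - D)
    have hflow : IsFlow (D' - D) (flowOfTops (D' - D) t) := isFlow_flowOfTops t hdeg
    have hpot : L.IsPotentialFlow (D' - D) (flowOfTops (D' - D) t) := by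
      refine ⟨hflow, fun i => ?_⟩
      have hpos := pairing_pos_eq hflow i
      rw [flowOfTops_top, add_sub_cancel_right, map_sub, hz] at hpos
      linarith
    obtain ⟨f, hf, -⟩ := hpot.exists_isDiv
    exact ⟨f, hf⟩

/-! ### The canonical divisor and its representatives -/

section Canonical

variable {g : ℕ} {L : ChainLengths g}

variable (L) in
/-- The canonical divisor of the chain, with chips at the vertices of the loops; a bridge to a
leaf contributes `-1` at the leaf. -/
def canonical : L.graph.Divisor :=
  ∑ k : Fin g, (Finsupp.single (.vertex (L.bridgeTgt k.castSucc)) 1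
    + Finsupp.single (.vertex (L.bridgeSrc k.succ)) 1)
    - Finsupp.single L.leftEnd 1 - Finsupp.single L.rightEnd 1

theorem leftEnd_eq : L.leftEnd = .vertex (L.bridgeSrc 0) := rfl

theorem rightEnd_eq : L.rightEnd = .vertex (L.bridgeTgt (Fin.last g)) := rfl

theorem pairing_canonical {R : Type*} [CommRing R] (w : L.graph.Point → R) :
    pairing w L.canonical =
      ∑ k : Fin g, (w (.vertex (L.bridgeTgt k.castSucc)) + w (.vertex (L.bridgeSrc k.succ)))
        - w L.leftEnd - w L.rightEnd := by
  simp [canonical]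

theorem canonical_bridgeSrc_zero : L.canonical (.vertex (L.bridgeSrc 0)) = -1 := by
  classical
  simp [canonical, leftEnd_eq, rightEnd_eq, Fin.succ_ne_zero]

theorem canonical_bridgeSrc_succ (k : Fin g) :
    L.canonical (.vertex (L.bridgeSrc k.succ)) = 1 := by
  classical
  simp [canonical, leftEnd_eq, rightEnd_eq, Finsupp.single_apply]

theorem canonical_bridgeTgt_castSucc (k : Fin g) :
    L.canonical (.vertex (L.bridgeTgt k.castSucc)) = 1 := by
  classical
  simp [canonical, leftEnd_eq, rightEnd_eq, Finsupp.single_apply]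

theorem canonical_bridgeTgt_last : L.canonical (.vertex (L.bridgeTgt (Fin.last g))) = -1 := by
  classical
  simp [canonical, leftEnd_eq, rightEnd_eq, Fin.castSucc_ne_last]

theorem deg_canonical : deg L.canonical = 2 * g - 2 := by
  rw [← pairing_const_one, pairing_canonical, Finset.sum_const, Finset.card_univ, Fintype.card_fin,
    nsmul_eq_mul]
  ring

theorem pairing_pos_canonical (k : Fin g) :
    pairing (pos k) L.canonical = 2 * ((g : ℝ) - 1 - k) * L.m (k + 1) := by
  have pos_tgt (i : Fin g) : pos k (.vertex (L.bridgeTgt i.castSucc))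
      = if k < i then L.m (k + 1) else 0 := by
    split_ifs with h
    · exact pos_of_lt_level (by rw [level_bridgeTgt, Fin.val_castSucc]; omega)
    · exact pos_of_level_lt (by rw [level_bridgeTgt, Fin.val_castSucc]; omega)
  have pos_src (i : Fin g) : pos k (.vertex (L.bridgeSrc i.succ))
      = if k ≤ i then L.m (k + 1) else 0 := by
    split_ifs with h
    · exact pos_of_lt_level (by rw [level_bridgeSrc, Fin.val_succ]; omega)
    · exact pos_of_level_lt (by rw [level_bridgeSrc, Fin.val_succ]; omega)
  have hk : (k : ℕ) < g := k.isLt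
  simp only [pairing_canonical, pos_leftEnd, pos_rightEnd, pos_tgt, pos_src,
    Finset.sum_add_distrib, ← Finset.sum_filter, Finset.sum_const, nsmul_eq_mul]
  rw [Finset.filter_lt_eq_Ioi, Finset.filter_le_eq_Ici, Fin.card_Ioi, Fin.card_Ici,
    Nat.cast_sub hk.le, Nat.cast_sub (by omega), Nat.cast_sub (by omega)]
  push_cast
  ring

theorem pairing_endsDivisor {R : Type*} [CommRing R] (w : L.graph.Point → R) (r i : ℕ) :
    pairing w (L.endsDivisor r i) = i * w L.leftEnd + ((r : R) - i) * w L.rightEnd := by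
  simp [endsDivisor, sub_mul]

theorem endsDivisor_bridgeSrc (r i : ℕ) (j : Fin (g + 1)) :
    L.endsDivisor r i (.vertex (L.bridgeSrc j)) = if j = 0 then (i : ℤ) else 0 := by
  classical
  simp [endsDivisor, leftEnd_eq, rightEnd_eq, Finsupp.single_apply, eq_comm]

theorem endsDivisor_bridgeTgt (r i : ℕ) (j : Fin (g + 1)) :
    L.endsDivisor r i (.vertex (L.bridgeTgt j)) = if j = Fin.last g then (r : ℤ) - i else 0 := by
  classical
  simp only [endsDivisor, leftEnd_eq, rightEnd_eq, Finsupp.add_apply, Finsupp.single_apply,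
    Point.vertex.injEq, bridgeTgt_inj, eq_comm, bridgeTgt_ne_bridgeSrc, if_false, zero_add]

theorem top_ne_bridge (j : Fin (g + 1)) (k : Fin g) : L.top k ≠ L.bridge j := Sum.inr_ne_inl

theorem top_ne_bot (j k : Fin g) : L.top k ≠ L.bot j :=
  fun h => Sum.inl_ne_inr (Sum.inr_injective h)

theorem top_inj {j k : Fin g} : L.top j = L.top k ↔ j = k :=
  (Sum.inr_injective.comp Sum.inl_injective).eq_iff

end Canonical

variable {r : ℕ} {L : ChainLengths (r + 1)}

variable (L) in
/-- Every loop is longer than `2 r` times its bottom edge. -/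
def LongLoops : Prop := ∀ k : Fin (r + 1), 2 * (r : ℝ) * L.m (k + 1) < L.ℓ (k + 1) + L.m (k + 1)

variable (L) in
/-- The position on its top edge of the chip on the loop `k` of the `i`-th divisor. -/
def chipPos (i k : Fin (r + 1)) : ℝ :=
  if k < i then L.ℓ (k + 1) - ((i : ℝ) - k) * L.m (k + 1) else ((k : ℝ) - i) * L.m (k + 1)

variable (L) in
/-- The chip on the loop `k` of the `i`-th divisor. -/
def chip (i k : Fin (r + 1)) : L.graph.Point := onEdge (L.top k) (L.chipPos i k)

variable (L) in
/-- The divisor equivalent to the canonical divisor with multiplicity `i` at the left end and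
`r - i` at the right end, the divisor `D_i` of the paper: it has one chip on every loop except the
loop `i`. -/
def endsRep (i : Fin (r + 1)) : L.graph.Divisor :=
  L.endsDivisor r i + ∑ k ∈ Finset.univ.erase i, Finsupp.single (L.chip i k) 1

variable (L) in
/-- The initial slopes of the function with divisor `endsRep i - canonical`. -/
def endsSlope (i : Fin (r + 1)) : L.graph.E → ℤ :=
  Sum.elim (fun j : Fin (r + 1 + 1) => (j : ℤ) - 1 - i + if (i : ℕ) < j then 1 else 0)
    (Sum.elim (fun k : Fin (r + 1) => if k ≤ i then 0 else 1)
      (fun k : Fin (r + 1) => (k : ℤ) - i))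

section Slopes

variable (i : Fin (r + 1))

theorem endsSlope_bridge (j : Fin (r + 1 + 1)) :
    L.endsSlope i (L.bridge j) = (j : ℤ) - 1 - i + if (i : ℕ) < j then 1 else 0 := rfl

theorem endsSlope_top (k : Fin (r + 1)) : L.endsSlope i (L.top k) = if k ≤ i then 0 else 1 := rfl

theorem endsSlope_bot (k : Fin (r + 1)) : L.endsSlope i (L.bot k) = (k : ℤ) - i := rfl

end Slopes

theorem LongLoops.chip_eq (hL : L.LongLoops) {i k : Fin (r + 1)} (hk : k ≠ i) :
    ∃ h0 h1, L.chip i k = .inner (L.top k) (L.chipPos i k) h0 h1 := by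
  have hm : 0 < L.m (k + 1) := L.m_pos _ (by omega) (by omega)
  have hl := hL k
  have hi : ((i : ℕ) : ℝ) ≤ r := by exact_mod_cast Nat.le_of_lt_succ i.isLt
  have hk' : ((k : ℕ) : ℝ) ≤ r := by exact_mod_cast Nat.le_of_lt_succ k.isLt
  have h : 0 < L.chipPos i k ∧ L.chipPos i k < L.graph.len (L.top k) := by
    rw [len_top, chipPos]
    split_ifs with h
    · have h' : ((k : ℕ) : ℝ) + 1 ≤ (i : ℕ) := by exact_mod_cast h
      constructor <;> nlinarith [(k : ℕ).cast_nonneg (α := ℝ)]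
    · have h' : ((i : ℕ) : ℝ) + 1 ≤ (k : ℕ) := by
        exact_mod_cast lt_of_le_of_ne (not_lt.1 h) hk.symm
      constructor
      · exact mul_pos (by linarith) hm
      · nlinarith [(i : ℕ).cast_nonneg (α := ℝ)]
  exact ⟨h.1, h.2, onEdge_inner _ h.1 h.2⟩

theorem LongLoops.level_chip (hL : L.LongLoops) {i k : Fin (r + 1)} (hk : k ≠ i) :
    level (L.chip i k) = 2 * k + 1 := by
  obtain ⟨h0, h1, h⟩ := hL.chip_eq hk
  rw [h, level_inner_top]

theorem pairing_endsRep {R : Type*} [CommRing R] (w : L.graph.Point → R) (i : Fin (r + 1)) :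
    pairing w (L.endsRep i) = i * w L.leftEnd + ((r : R) - i) * w L.rightEnd
      + ∑ k ∈ Finset.univ.erase i, w (L.chip i k) := by
  simp [endsRep, pairing_endsDivisor]

section InnerOn

variable (hL : L.LongLoops) (i : Fin (r + 1)) {R : Type*} [CommRing R] (φ : ℝ → R)
include hL

open Classical in
theorem pairing_innerOn_endsRep_sub (e : L.graph.E) :
    pairing (innerOn e φ) (L.endsRep i - L.canonical) =
      ∑ k ∈ Finset.univ.erase i, if L.top k = e then φ (L.chipPos i k) else 0 := by
  rw [map_sub, pairing_endsRep, pairing_canonical]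
  simp only [leftEnd, rightEnd, innerOn, mul_zero, add_zero, zero_add, Finset.sum_const_zero,
    sub_zero]
  refine Finset.sum_congr rfl fun k hk => ?_
  obtain ⟨h0, h1, h⟩ := hL.chip_eq (Finset.ne_of_mem_erase hk)
  rw [h]

theorem pairing_innerOn_bridge (j : Fin (r + 1 + 1)) :
    pairing (innerOn (L.bridge j) φ) (L.endsRep i - L.canonical) = 0 := by
  rw [pairing_innerOn_endsRep_sub hL]
  exact Finset.sum_eq_zero fun k _ => if_neg (top_ne_bridge j k)

theorem pairing_innerOn_bot (j : Fin (r + 1)) :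
    pairing (innerOn (L.bot j) φ) (L.endsRep i - L.canonical) = 0 := by
  rw [pairing_innerOn_endsRep_sub hL]
  exact Finset.sum_eq_zero fun k _ => if_neg (top_ne_bot j k)

theorem pairing_innerOn_top (j : Fin (r + 1)) :
    pairing (innerOn (L.top j) φ) (L.endsRep i - L.canonical)
      = if j = i then 0 else φ (L.chipPos i j) := by
  rw [pairing_innerOn_endsRep_sub hL]
  simp only [top_inj, Finset.sum_ite_eq', Finset.mem_erase, Finset.mem_univ, and_true, ne_eq,
    ite_not]

end InnerOn

theorem LongLoops.endsRep_vertex (hL : L.LongLoops) (i : Fin (r + 1)) (v : L.graph.V) :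
    L.endsRep i (.vertex v) = L.endsDivisor r i (.vertex v) := by
  rw [endsRep, Finsupp.add_apply, Finsupp.finsetSum_apply, Finset.sum_eq_zero, add_zero]
  intro k hk
  obtain ⟨h0, h1, h⟩ := hL.chip_eq (Finset.ne_of_mem_erase hk)
  rw [h, Finsupp.single_apply_eq_zero]
  exact fun h => nomatch h

section Flow

variable (hL : L.LongLoops) (i : Fin (r + 1))
include hL

theorem endsRep_sub_bridgeSrc (j : Fin (r + 1 + 1)) :
    (L.endsRep i - L.canonical) (.vertex (L.bridgeSrc j))
      = netFlow (L.endsRep i - L.canonical) (L.endsSlope i) (L.bridgeSrc j) := by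
  rw [Finsupp.sub_apply, hL.endsRep_vertex, endsDivisor_bridgeSrc]
  refine Fin.cases ?_ (fun k => ?_) j
  · rw [canonical_bridgeSrc_zero, netFlow_bridgeSrc_zero, endsSlope_bridge, if_pos rfl,
      if_neg (by simp), Fin.val_zero]
    push_cast
    ring
  · rw [canonical_bridgeSrc_succ, netFlow_bridgeSrc_succ, endsSlope_bridge, endsSlope_top,
      endsSlope_bot, edgeDeg, edgeDeg, pairing_innerOn_top hL, pairing_innerOn_bot hL,
      if_neg (Fin.succ_ne_zero k), Fin.val_succ]
    split_ifs <;> omega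

theorem endsRep_sub_bridgeTgt (j : Fin (r + 1 + 1)) :
    (L.endsRep i - L.canonical) (.vertex (L.bridgeTgt j))
      = netFlow (L.endsRep i - L.canonical) (L.endsSlope i) (L.bridgeTgt j) := by
  rw [Finsupp.sub_apply, hL.endsRep_vertex, endsDivisor_bridgeTgt]
  refine Fin.lastCases ?_ (fun k => ?_) j
  · rw [canonical_bridgeTgt_last, netFlow_bridgeTgt_last, endsSlope_bridge, edgeDeg,
      pairing_innerOn_bridge hL, if_pos rfl, Fin.val_last, if_pos i.isLt]
    push_cast
    ring
  · rw [canonical_bridgeTgt_castSucc, netFlow_bridgeTgt_castSucc, endsSlope_bridge, endsSlope_top,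
      endsSlope_bot, edgeDeg, pairing_innerOn_bridge hL, if_neg (Fin.castSucc_ne_last k),
      Fin.val_castSucc]
    split_ifs <;> omega

theorem rise_endsRep_top (k : Fin (r + 1)) :
    rise (L.endsRep i - L.canonical) (L.endsSlope i) (L.top k)
      = rise (L.endsRep i - L.canonical) (L.endsSlope i) (L.bot k) := by
  rw [rise, rise, edgeMoment, edgeMoment, edgeDeg, edgeDeg, pairing_innerOn_top hL,
    pairing_innerOn_top hL, pairing_innerOn_bot hL, pairing_innerOn_bot hL, len_top, len_bot,
    endsSlope_top, endsSlope_bot, chipPos]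
  rcases lt_trichotomy k i with h | rfl | h
  · rw [if_pos h.le, if_neg h.ne, if_neg h.ne, if_pos h]
    push_cast
    ring
  · simp
  · rw [if_neg h.not_ge, if_neg h.ne', if_neg h.ne', if_neg h.not_gt]
    push_cast
    ring

theorem LongLoops.isPotentialFlow :
    L.IsPotentialFlow (L.endsRep i - L.canonical) (L.endsSlope i) where
  isFlow := L.forall_vertex.2 ⟨endsRep_sub_bridgeSrc hL i, endsRep_sub_bridgeTgt hL i⟩
  rise_top := rise_endsRep_top hL i

theorem LongLoops.isEndsRep : L.IsEndsRep L.canonical r i (L.endsRep i) := by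
  obtain ⟨f, hf, -⟩ := (hL.isPotentialFlow i).exists_isDiv
  refine ⟨⟨f, hf⟩, ?_⟩
  rw [endsRep, add_sub_cancel_left]
  exact Finset.sum_nonneg fun k _ => Finsupp.single_nonneg.2 zero_le_one

theorem rise_endsRep_bridge (j : Fin (r + 1 + 1)) :
    rise (L.endsRep i - L.canonical) (L.endsSlope i) (L.bridge j)
      = L.n j * (j - 1 - i + if (i : ℕ) < j then 1 else 0) := by
  rw [rise, edgeMoment, edgeDeg, pairing_innerOn_bridge hL, pairing_innerOn_bridge hL,
    endsSlope_bridge, len_bridge]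
  push_cast
  ring

theorem rise_endsRep_bot (k : Fin (r + 1)) :
    rise (L.endsRep i - L.canonical) (L.endsSlope i) (L.bot k) = L.m (k + 1) * (k - i) := by
  rw [rise, edgeMoment, edgeDeg, pairing_innerOn_bot hL, pairing_innerOn_bot hL, endsSlope_bot,
    len_bot]
  push_cast
  ring

end Flow

/-- The value at `w_j` of the function with divisor `endsRep i - canonical` that vanishes at
`w_0`. -/
def endsValue {g : ℕ} (L : ChainLengths g) (i j : ℕ) : ℝ :=
  ∑ l ∈ Finset.range j,
    (L.n l * (l - 1 - i + if i < l then 1 else 0) + L.m (l + 1) * (l - i))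

theorem LongLoops.apply_bridgeSrc (hL : L.LongLoops) {I : Multiset (Fin (r + 1))}
    {f : L.graph.Point → ℝ}
    (h : HasInitialSlopes f (I.map fun i => L.endsRep i - L.canonical).sum (I.map L.endsSlope).sum)
    (h0 : f L.leftEnd = 0) (j : Fin (r + 1 + 1)) :
    f (.vertex (L.bridgeSrc j)) = (I.map fun i : Fin (r + 1) => L.endsValue i j).sum := by
  induction j using Fin.induction with
  | zero => simpa only [Fin.val_zero, endsValue, Finset.sum_range_zero, Multiset.sum_map_zero,
      leftEnd_eq] using h0
  | succ k ih =>
    have hbridge := h.rise_eq_sub (L.bridge k.castSucc)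
    have hbot := h.rise_eq_sub (L.bot k)
    rw [tgt_bridge, src_bridge, rise_multiset_sum, ih, eq_sub_iff_add_eq'] at hbridge
    rw [tgt_bot, src_bot, rise_multiset_sum, eq_sub_iff_add_eq', ← hbridge] at hbot
    rw [← hbot, ← Multiset.sum_map_add, ← Multiset.sum_map_add]
    refine congrArg _ (Multiset.map_congr rfl fun i _ => ?_)
    rw [rise_endsRep_bridge hL, rise_endsRep_bot hL, Fin.val_castSucc, Fin.val_succ, endsValue,
      endsValue, Finset.sum_range_succ, add_assoc]

theorem LongLoops.exists_isDiv (hL : L.LongLoops) (I : Multiset (Fin (r + 1))) :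
    ∃ f : L.graph.Point → ℝ,
      IsDiv f ((I.map L.endsRep).sum - Multiset.card I • L.canonical) ∧
      ∀ j : Fin (r + 1 + 1), ∀ t ∈ Set.Icc 0 (L.n j), f (onEdge (L.bridge j) t) =
        (I.map fun i : Fin (r + 1) => L.endsValue i j
          + ((j : ℝ) - 1 - i + if (i : ℕ) < j then 1 else 0) * t).sum := by
  obtain ⟨f, hf, hslopes, h0⟩ := (IsPotentialFlow.multiset_sum hL.isPotentialFlow I).exists_isDiv
  have hdiv : (I.map fun i => L.endsRep i - L.canonical).sum
      = (I.map L.endsRep).sum - Multiset.card I • L.canonical := by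
    rw [Multiset.sum_map_sub, Multiset.map_const', Multiset.sum_replicate]
  refine ⟨f, hdiv ▸ hf, fun j t ht => ?_⟩
  have hbend : bend (I.map fun i => L.endsRep i - L.canonical).sum (L.bridge j) t = 0 := by
    rw [bend, map_multiset_sum, Multiset.map_map]
    exact Multiset.sum_eq_zero fun x hx => by
      obtain ⟨i, _, rfl⟩ := Multiset.mem_map.1 hx
      exact pairing_innerOn_bridge hL i _ j
  have hslope : (((I.map L.endsSlope).sum (L.bridge j) : ℤ) : ℝ)
      = (I.map fun i : Fin (r + 1) => (j : ℝ) - 1 - i + if (i : ℕ) < j then 1 else 0).sum := by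
    refine (map_multiset_sum ((Int.castAddHom ℝ).comp (Pi.evalAddMonoidHom (fun _ => ℤ)
      (L.bridge j))) _).trans (congrArg _ ?_)
    rw [Multiset.map_map]
    refine Multiset.map_congr rfl fun i _ => ?_
    simp [endsSlope_bridge]
  rw [hslopes (L.bridge j) t ht, src_bridge, hL.apply_bridgeSrc hslopes h0, hbend, sub_zero, hslope,
    ← Multiset.sum_map_mul_right, Multiset.sum_map_add]

section Chips

variable {g : ℕ} {L : ChainLengths g}

/-! ### Chips on the loops -/

/-- The number of chips in the interior of the edges of the loop `k`. -/
abbrev chipsOn (k : ℕ) : L.graph.Divisor →+ ℤ := count fun x => level x = 2 * k + 1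

/-- The number of chips to the left of the interior of the edges of the loop `k`. -/
abbrev chipsLeft (k : ℕ) : L.graph.Divisor →+ ℤ := count fun x => level x < 2 * k + 1

/-- The number of chips to the right of the interior of the edges of the loop `k`. -/
abbrev chipsRight (k : ℕ) : L.graph.Divisor →+ ℤ := count fun x => 2 * k + 1 < level x

theorem sum_ite_level_eq (s : Finset (Fin g)) (x : L.graph.Point) :
    (∑ k ∈ s, if level x = 2 * k + 1 then (1 : ℤ) else 0)
      = if ∃ k ∈ s, level x = 2 * k + 1 then 1 else 0 := by
  split_ifs with h
  · obtain ⟨k, hk, hx⟩ := h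
    rw [Finset.sum_eq_single_of_mem k hk, if_pos hx]
    exact fun b _ hb => if_neg fun h => hb (Fin.ext (by omega))
  · push Not at h
    exact Finset.sum_eq_zero fun k hk => if_neg (h k hk)

variable {F : L.graph.Divisor}

theorem card_le_count (hF : 0 ≤ F) {s : Finset (Fin g)} {p : L.graph.Point → Prop}
    [DecidablePred p] (hs : ∀ k ∈ s, chipsOn k F ≠ 0)
    (hp : ∀ k ∈ s, ∀ x : L.graph.Point, level x = 2 * k + 1 → p x) :
    (s.card : ℤ) ≤ count p F := by
  calc (s.card : ℤ) = ∑ k ∈ s, 1 := by rw [Finset.sum_const, nsmul_one]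
    _ ≤ ∑ k ∈ s, chipsOn k F :=
      Finset.sum_le_sum fun k hk => ((count_nonneg hF).lt_of_ne' (hs k hk) :)
    _ = pairing (fun x => if ∃ k ∈ s, level x = 2 * k + 1 then (1 : ℤ) else 0) F := by
      simp only [chipsOn, count, ← pairing_sum_left, sum_ite_level_eq]
    _ ≤ count p F := count_mono (fun x ⟨k, hk, hx⟩ => hp k hk x hx) hF

theorem chipsLeft_add_chipsOn_add_chipsRight (k : ℕ) (F : L.graph.Divisor) :
    chipsLeft k F + chipsOn k F + chipsRight k F = deg F := by
  rw [chipsLeft, chipsOn, chipsRight, ← pairing_const_one, count, count, count, ← pairing_add_left,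
    ← pairing_add_left]
  congr 2
  funext x
  split_ifs <;> omega

theorem deg_le_chipsLeft_succ_add_chipsRight (hF : 0 ≤ F) (k : ℕ) :
    deg F ≤ chipsLeft (k + 1) F + chipsRight k F := by
  rw [chipsLeft, chipsRight, ← pairing_const_one, count, count, ← pairing_add_left]
  refine pairing_mono (fun x => ?_) hF
  split_ifs <;> omega

theorem exists_chipsOn_eq_zero (hF : 0 ≤ F) (hd : deg F < g) :
    ∃ k : Fin g, chipsOn k F = 0 := by
  by_contra! h
  have := card_le_count hF (s := Finset.univ) (p := fun _ => True) (fun k _ => h k)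
    fun _ _ _ _ => trivial
  rw [count_true, Finset.card_univ, Fintype.card_fin] at this
  omega

theorem le_chipsLeft (hF : 0 ≤ F) {k : Fin g} (h : ∀ i : Fin g, i < k → chipsOn i F ≠ 0) :
    (k : ℤ) ≤ chipsLeft k F := by
  have hcard : ((Finset.Iio k).card : ℤ) ≤ chipsLeft k F :=
    card_le_count hF (fun i hi => h i (Finset.mem_Iio.1 hi)) fun i hi x hx => by
      have : (i : ℕ) < k := Fin.lt_def.1 (Finset.mem_Iio.1 hi)
      omega
  rwa [Fin.card_Iio] at hcard

theorem le_chipsRight (hF : 0 ≤ F) {k : Fin g} (h : ∀ i : Fin g, k < i → chipsOn i F ≠ 0) :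
    (g : ℤ) - 1 - k ≤ chipsRight k F := by
  have hcard : ((Finset.Ioi k).card : ℤ) ≤ chipsRight k F :=
    card_le_count hF (fun i hi => h i (Finset.mem_Ioi.1 hi)) fun i hi x hx => by
      have : (k : ℕ) < i := Fin.lt_def.1 (Finset.mem_Ioi.1 hi)
      omega
  rw [Fin.card_Ioi] at hcard
  omega

theorem exists_balanced (hF : 0 ≤ F) (hd : deg F + 1 = g) :
    ∃ k : Fin g, chipsOn k F = 0 ∧ chipsRight k F = deg F - k := by
  have hdeg : 0 ≤ deg F := (count_nonneg hF).trans_eq (count_true F)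
  have hex : ∃ k : ℕ, deg F - k ≤ chipsRight k F :=
    ⟨g - 1, (by omega : deg F - (g - 1 : ℕ) ≤ 0).trans (count_nonneg hF)⟩
  classical
  obtain ⟨k, hk, hmin⟩ : ∃ k : ℕ, deg F - k ≤ chipsRight k F ∧
      ∀ i < k, chipsRight i F < deg F - i :=
    ⟨Nat.find hex, Nat.find_spec hex, fun i hi => not_le.1 (Nat.find_min hex hi)⟩
  have hkg : k < g := by
    by_contra! h
    have := hmin (g - 1) (by omega)
    have : 0 ≤ chipsRight (g - 1) F := count_nonneg hF
    omega
  have hleft : (k : ℤ) ≤ chipsLeft k F := by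
    cases k with
    | zero => exact count_nonneg hF
    | succ k =>
      have := hmin k k.lt_succ_self
      have := deg_le_chipsLeft_succ_add_chipsRight hF k
      omega
  have hsum := chipsLeft_add_chipsOn_add_chipsRight k F
  have hon : 0 ≤ chipsOn k F := count_nonneg hF
  exact ⟨⟨k, hkg⟩, by dsimp only; omega, by dsimp only; omega⟩

theorem pairing_pos_of_chipsOn_eq_zero (hF : 0 ≤ F) {k : Fin g} (h : chipsOn k F = 0) :
    pairing (pos k) F = chipsRight k F * L.m (k + 1) := by
  rw [chipsRight, count, intCast_pairing, mul_comm, ← pairing_mul_left]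
  refine pairing_congr fun x hx => ?_
  have hne : level x ≠ 2 * k + 1 := fun h' => hx (eq_zero_of_count_eq_zero hF h h')
  rcases lt_or_gt_of_ne hne with hlt | hlt
  · rw [pos_of_level_lt hlt, if_neg hlt.not_gt, Int.cast_zero, mul_zero]
  · rw [pos_of_lt_level hlt, if_pos hlt, Int.cast_one, mul_one]

theorem pairing_pos_sum_single_of_notMem {s : Finset (Fin g)} {x : Fin g → L.graph.Point}
    (hx : ∀ j ∈ s, 2 * j ≤ level (x j) ∧ level (x j) ≤ 2 * j + 2) {k : Fin g} (hk : k ∉ s) :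
    pairing (pos k) (∑ j ∈ s, Finsupp.single (x j) 1)
      = (s.filter (k < ·)).card * L.m (k + 1) := by
  rw [map_sum, ← nsmul_eq_mul, ← Finset.sum_const, Finset.sum_filter]
  refine Finset.sum_congr rfl fun j hj => ?_
  have hlevel := hx j hj
  have hne : (k : ℕ) ≠ j := Fin.val_ne_of_ne (ne_of_mem_of_not_mem hj hk).symm
  rw [pairing_single, Int.cast_one, one_mul]
  split_ifs with h
  · exact pos_of_lt_level (by omega)
  · exact pos_of_level_lt (by omega)

theorem pairing_pos_sum_single_of_mem {s : Finset (Fin g)} {x : Fin g → L.graph.Point}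
    (hx : ∀ j ∈ s, 2 * j ≤ level (x j) ∧ level (x j) ≤ 2 * j + 2) {k : Fin g} (hk : k ∈ s) :
    pairing (pos k) (∑ j ∈ s, Finsupp.single (x j) 1)
      = pos k (x k) + (s.filter (k < ·)).card * L.m (k + 1) := by
  rw [← Finset.add_sum_erase _ _ hk, map_add, pairing_single, Int.cast_one, one_mul,
    pairing_pos_sum_single_of_notMem (fun j hj => hx j (Finset.mem_of_mem_erase hj))
      (Finset.notMem_erase k s), Finset.filter_erase, Finset.erase_eq_of_notMem]
  simp

theorem sum_single_le (hF : 0 ≤ F) {s : Finset (Fin g)} {x : Fin g → L.graph.Point}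
    (hx : ∀ k ∈ s, level (x k) = 2 * k + 1) (hFx : ∀ k ∈ s, F (x k) ≠ 0) :
    ∑ k ∈ s, Finsupp.single (x k) (1 : ℤ) ≤ F := by
  classical
  intro y
  rw [Finsupp.finsetSum_apply]
  by_cases h : ∃ k ∈ s, x k = y
  · obtain ⟨k, hk, rfl⟩ := h
    rw [Finset.sum_eq_single_of_mem k hk, Finsupp.single_eq_same]
    · exact (hF (x k)).lt_of_ne' (hFx k hk)
    · refine fun i hi hik => Finsupp.single_eq_of_ne' fun h => hik (Fin.ext ?_)
      have := hx i hi
      rw [h, hx k hk] at this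
      omega
  · push Not at h
    exact (Finset.sum_eq_zero fun k hk => Finsupp.single_eq_of_ne' (h k hk)).trans_le (hF y)

theorem exists_eq_sum_single (hF : 0 ≤ F) {s : Finset (Fin g)} (hd : deg F = s.card)
    (hs : ∀ k ∈ s, chipsOn k F ≠ 0) : ∃ x : Fin g → L.graph.Point,
      (∀ k ∈ s, level (x k) = 2 * k + 1) ∧ F = ∑ k ∈ s, Finsupp.single (x k) 1 := by
  have : Nonempty L.graph.Point := ⟨L.leftEnd⟩
  choose! x hx hFx using fun k hk => exists_of_count_ne_zero (hs k hk)
  exact ⟨x, hx, (eq_of_le_of_deg_eq (sum_single_le hF hx hFx) (by rw [hd, deg_sum_single])).symm⟩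

end Chips

section Loops

variable {g : ℕ} (L : ChainLengths g)

theorem loop_pos (k : Fin g) : 0 < L.ℓ (k + 1) + L.m (k + 1) :=
  add_pos (L.ℓ_pos _ (by omega) (by omega)) (L.m_pos _ (by omega) (by omega))

theorem exists_point_on_loop (k : Fin g) (a : ℝ) : ∃ x : L.graph.Point,
    (2 * k ≤ level x ∧ level x ≤ 2 * k + 2) ∧
      ∃ z : ℤ, pos k x = a + z * (L.ℓ (k + 1) + L.m (k + 1)) := by
  have hs := L.loop_pos k
  obtain ⟨b, ⟨h0, hb⟩, z, hz⟩ : ∃ b ∈ Set.Ico 0 (L.ℓ (k + 1) + L.m (k + 1)),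
      ∃ z : ℤ, b = a + z * (L.ℓ (k + 1) + L.m (k + 1)) := by
    refine ⟨toIcoMod hs 0 a, toIcoMod_mem_Ico' hs a, -toIcoDiv hs 0 a, ?_⟩
    rw [toIcoMod, zsmul_eq_mul, Int.cast_neg, neg_mul, sub_eq_add_neg]
  rcases h0.eq_or_lt with rfl | h0
  · exact ⟨.vertex (L.bridgeTgt k.castSucc), ⟨le_rfl, Nat.le_add_right _ _⟩, z,
      (pos_bridgeTgt_castSucc k).trans hz⟩
  rcases lt_trichotomy b (L.m (k + 1)) with hlt | rfl | hlt
  · have hlt' : b < L.graph.len (L.bot k) := hlt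
    refine ⟨.inner (L.bot k) b h0 hlt', by rw [level_inner_bot]; omega, z, ?_⟩
    rw [pos_of_level_eq (level_inner_bot ..), coord_inner_bot, hz]
  · exact ⟨.vertex (L.bridgeSrc k.succ), by rw [level_bridgeSrc, Fin.val_succ]; omega, z,
      (pos_bridgeSrc_succ k).trans hz⟩
  · refine ⟨.inner (L.top k) (L.ℓ (k + 1) + L.m (k + 1) - b) (by linarith)
      (by rw [len_top]; linarith), by rw [level_inner_top]; omega, z - 1, ?_⟩
    rw [pos_of_level_eq (level_inner_top ..), coord_inner_top, hz]
    push_cast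
    ring

variable {L}

theorem exists_of_level_eq {k : Fin g} {x : L.graph.Point} (h : level x = 2 * k + 1) :
    (∃ t h0 h1, x = .inner (L.top k) t h0 h1) ∨ ∃ t h0 h1, x = .inner (L.bot k) t h0 h1 := by
  cases x with
  | vertex v =>
    revert v
    rw [forall_vertex]
    refine ⟨fun j h => ?_, fun j h => ?_⟩
    · rw [level_bridgeSrc] at h; omega
    · rw [level_bridgeTgt] at h; omega
  | inner e t h0 h1 =>
    revert e
    rw [forall_edge]
    refine ⟨fun j h1 h => ?_, fun i h1 h => ?_, fun i h1 h => ?_⟩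
    · rw [level_inner_bridge] at h; omega
    · rw [level_inner_top] at h
      obtain rfl : i = k := Fin.ext (by omega)
      exact Or.inl ⟨t, h0, h1, rfl⟩
    · rw [level_inner_bot] at h
      obtain rfl : i = k := Fin.ext (by omega)
      exact Or.inr ⟨t, h0, h1, rfl⟩

theorem eq_zero_of_abs_mul_lt {z : ℤ} {s : ℝ} (h : |z * s| < s) : z = 0 := by
  have hs : 0 < s := (abs_nonneg _).trans_lt h
  rw [abs_mul, abs_of_pos hs, mul_lt_iff_lt_one_left hs] at h
  exact Int.abs_lt_one_iff.1 (by exact_mod_cast h)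

theorem coord_mem_Ioo {k : Fin g} {x : L.graph.Point} (h : level x = 2 * k + 1) :
    coord x ∈ Set.Ioo (-L.ℓ (k + 1)) (L.m (k + 1)) := by
  have hm : 0 < L.m (k + 1) := L.m_pos _ (by omega) (by omega)
  have hl : 0 < L.ℓ (k + 1) := L.ℓ_pos _ (by omega) (by omega)
  rcases exists_of_level_eq h with ⟨t, h0, h1, rfl⟩ | ⟨t, h0, h1, rfl⟩
  · rw [len_top] at h1
    exact ⟨neg_lt_neg h1, (neg_neg_of_pos h0).trans hm⟩
  · exact ⟨(neg_neg_of_pos hl).trans h0, h1⟩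

theorem eq_of_coord_eq {k : Fin g} {x y : L.graph.Point} (hx : level x = 2 * k + 1)
    (hy : level y = 2 * k + 1) (h : coord x = coord y) : x = y := by
  rcases exists_of_level_eq hx with ⟨t, h0, h1, rfl⟩ | ⟨t, h0, h1, rfl⟩ <;>
  rcases exists_of_level_eq hy with ⟨u, h2, h3, rfl⟩ | ⟨u, h2, h3, rfl⟩ <;>
  simp only [coord_inner_top, coord_inner_bot, neg_inj] at h
  · subst h
    rfl
  · linarith
  · linarith
  · subst h
    rfl

theorem eq_of_coord_eq_add_mul {k : Fin g} {x y : L.graph.Point} (hx : level x = 2 * k + 1)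
    (hy : level y = 2 * k + 1) {z : ℤ}
    (h : coord x = coord y + z * (L.ℓ (k + 1) + L.m (k + 1))) : x = y := by
  obtain ⟨hx0, hx1⟩ := coord_mem_Ioo hx
  obtain ⟨hy0, hy1⟩ := coord_mem_Ioo hy
  have hz : z = 0 := eq_zero_of_abs_mul_lt (s := L.ℓ (k + 1) + L.m (k + 1)) (by
    rw [abs_lt]
    constructor <;> linarith)
  exact eq_of_coord_eq hx hy (by rw [h, hz, Int.cast_zero, zero_mul, add_zero])

end Loops

/-! ### The rank and the class of the canonical divisor -/

section Class

variable {r : ℕ} {L : ChainLengths (r + 1)}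

theorem LongLoops.eq_of_mul_eq (hL : L.LongLoops) {k : Fin (r + 1)} {c c' z : ℤ}
    (hc : |c - c'| ≤ 2 * r)
    (h : (c : ℝ) * L.m (k + 1) = c' * L.m (k + 1) + z * (L.ℓ (k + 1) + L.m (k + 1))) :
    c = c' := by
  have hm : 0 < L.m (k + 1) := L.m_pos _ (by omega) (by omega)
  have hc' : |(c : ℝ) - c'| ≤ 2 * r := by exact_mod_cast hc
  have hsub : z * (L.ℓ (k + 1) + L.m (k + 1)) = (c - c') * L.m (k + 1) := by linarith
  have hz : z = 0 := eq_zero_of_abs_mul_lt <| by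
    calc |z * (L.ℓ (k + 1) + L.m (k + 1))| = |(c : ℝ) - c'| * L.m (k + 1) := by
          rw [hsub, abs_mul, abs_of_pos hm]
      _ ≤ 2 * r * L.m (k + 1) := by gcongr
      _ < L.ℓ (k + 1) + L.m (k + 1) := hL k
  rw [hz, Int.cast_zero, zero_mul, add_zero] at h
  exact_mod_cast mul_right_cancel₀ hm.ne' h

theorem LongLoops.not_rankAtLeast_canonical (hL : L.LongLoops) :
    ¬ RankAtLeast L.canonical (r + 1) := by
  intro h
  obtain ⟨F, hF, hlin⟩ := h (Finsupp.single L.leftEnd (r + 1 : ℕ))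
    (Finsupp.single_nonneg.2 (by positivity)) (deg_single _ _)
  obtain ⟨hd, hpos⟩ := (linEquiv_iff _ _).1 hlin
  have hdeg : deg F = r - 1 := by
    rw [hd, deg_sub, deg_canonical, deg_single]
    push_cast
    ring
  obtain ⟨k, hk⟩ :=
    exists_minimal_of_wellFoundedLT _ (exists_chipsOn_eq_zero hF (by push_cast; omega))
  have hleft := le_chipsLeft hF fun i hi => hk.not_prop_of_lt hi
  have hsum := chipsLeft_add_chipsOn_add_chipsRight k F
  have hright : 0 ≤ chipsRight k F := count_nonneg hF
  obtain ⟨z, hz⟩ := hpos k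
  rw [pairing_pos_of_chipsOn_eq_zero hF hk.prop, map_sub, pairing_pos_canonical, pairing_single,
    pos_leftEnd] at hz
  have heq : chipsRight k F = 2 * (r - k) := by
    refine hL.eq_of_mul_eq (k := k) (z := z) (by rw [abs_le, hk.prop] at *; omega) ?_
    rw [hz]
    push_cast
    ring
  have := hk.prop
  omega

theorem rankAtLeast_canonical (L : ChainLengths (r + 1)) : RankAtLeast L.canonical r := by
  intro E hE hdE
  obtain ⟨i, hi, hright⟩ := exists_balanced hE (by rw [hdE, Nat.cast_succ])
  choose x hx z hz using fun k : Fin (r + 1) => L.exists_point_on_loop k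
    (pairing (pos k) (L.canonical - E)
      - ((Finset.univ.erase i).filter (k < ·)).card * L.m (k + 1))
  refine ⟨∑ k ∈ Finset.univ.erase i, Finsupp.single (x k) 1,
    Finset.sum_nonneg fun k _ => Finsupp.single_nonneg.2 zero_le_one,
    (linEquiv_iff _ _).2 ⟨?_, fun k => ?_⟩⟩
  · rw [deg_sum_single, deg_sub, deg_canonical, hdE, Finset.card_erase_of_mem (Finset.mem_univ i),
      Finset.card_univ, Fintype.card_fin, Nat.add_sub_cancel]
    push_cast
    ring
  · rcases eq_or_ne k i with rfl | hk
    · refine ⟨0, ?_⟩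
      rw [pairing_pos_sum_single_of_notMem (fun j _ => hx j) (Finset.notMem_erase k _),
        Finset.filter_erase, Finset.erase_eq_of_notMem (by simp), Finset.filter_lt_eq_Ioi,
        Fin.card_Ioi, map_sub, pairing_pos_canonical, pairing_pos_of_chipsOn_eq_zero hE hi, hright,
        hdE, Nat.cast_sub (by omega), Nat.cast_sub (by omega)]
      push_cast
      ring
    · refine ⟨z k, ?_⟩
      rw [pairing_pos_sum_single_of_mem (fun j _ => hx j)
        (Finset.mem_erase.2 ⟨hk, Finset.mem_univ k⟩), hz]
      ring

section EndsRep

variable (hL : L.LongLoops) {i : Fin (r + 1)} {D : L.graph.Divisor}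
  (hD : L.IsEndsRep L.canonical r i D)
include hD

theorem deg_sub_endsDivisor : deg (D - L.endsDivisor r i) = r := by
  rw [deg_sub, ((linEquiv_iff _ _).1 hD.1).1, deg_canonical, ← pairing_const_one,
    pairing_endsDivisor]
  push_cast
  ring

include hL

theorem chipsRight_sub_endsDivisor {k : Fin (r + 1)}
    (hk : chipsOn k (D - L.endsDivisor r i) = 0) :
    chipsRight k (D - L.endsDivisor r i) = r - 2 * k + i := by
  obtain ⟨z, hz⟩ := ((linEquiv_iff _ _).1 hD.1).2 k
  have hnonneg : 0 ≤ chipsRight k (D - L.endsDivisor r i) := count_nonneg hD.2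
  have hle : chipsRight k (D - L.endsDivisor r i) ≤ deg (D - L.endsDivisor r i) :=
    count_le_deg hD.2
  have hpos := pairing_pos_of_chipsOn_eq_zero hD.2 hk
  rw [deg_sub_endsDivisor hD] at hle
  refine hL.eq_of_mul_eq (k := k) (z := z) (by rw [abs_le]; omega) ?_
  rw [← hpos, map_sub, hz, pairing_pos_canonical, pairing_endsDivisor, pos_leftEnd, pos_rightEnd]
  push_cast
  ring

theorem eq_of_chipsOn_sub_endsDivisor_eq_zero {k : Fin (r + 1)}
    (hk : chipsOn k (D - L.endsDivisor r i) = 0) : k = i := by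
  have hdeg := deg_sub_endsDivisor hD
  have hex : ∃ j : Fin (r + 1), chipsOn j (D - L.endsDivisor r i) = 0 := ⟨k, hk⟩
  obtain ⟨a, ha⟩ := exists_minimal_of_wellFoundedLT _ hex
  obtain ⟨b, hb⟩ := exists_maximal_of_wellFoundedGT _ hex
  have hleft := le_chipsLeft hD.2 fun j hj => ha.not_prop_of_lt hj
  have hright := le_chipsRight hD.2 fun j hj => hb.not_prop_of_gt hj
  have hsum := chipsLeft_add_chipsOn_add_chipsRight a (D - L.endsDivisor r i)
  have hak : a ≤ k := not_lt.1 fun h => ha.not_prop_of_lt h hk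
  have hkb : k ≤ b := not_lt.1 fun h => hb.not_prop_of_gt h hk
  have ha' := chipsRight_sub_endsDivisor hL hD ha.prop
  have hb' := chipsRight_sub_endsDivisor hL hD hb.prop
  rw [ha.prop] at hsum
  omega

theorem eq_endsRep : D = L.endsRep i := by
  obtain ⟨x, hx, hsum⟩ := exists_eq_sum_single hD.2 (s := Finset.univ.erase i)
    (by rw [deg_sub_endsDivisor hD]; simp) fun k hk h =>
      Finset.ne_of_mem_erase hk (eq_of_chipsOn_sub_endsDivisor_eq_zero hL hD h)
  have hchip : ∀ k ∈ Finset.univ.erase i, level (L.chip i k) = 2 * k + 1 :=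
    fun k hk => hL.level_chip (Finset.ne_of_mem_erase hk)
  rw [endsRep, ← sub_eq_iff_eq_add', hsum]
  refine Finset.sum_congr rfl fun k hk => congrArg (Finsupp.single · 1) ?_
  obtain ⟨z, hz⟩ := ((linEquiv_iff _ _).1 hD.1).2 k
  obtain ⟨z', hz'⟩ := ((linEquiv_iff _ _).1 (hL.isEndsRep i).1).2 k
  have hposx := pairing_pos_sum_single_of_mem (fun j hj => by rw [hx j hj]; omega) hk
  have hpos := pairing_pos_sum_single_of_mem (fun j hj => by rw [hchip j hj]; omega) hk
  rw [← hsum, map_sub, hz, pos_of_level_eq (hx k hk)] at hposx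
  rw [endsRep, map_add, hpos, pos_of_level_eq (hchip k hk)] at hz'
  refine eq_of_coord_eq_add_mul (hx k hk) (hchip k hk) (z := z - z') ?_
  push_cast
  linarith

end EndsRep

theorem LongLoops.isVertexAvoiding_canonical (hL : L.LongLoops) :
    L.IsVertexAvoiding L.canonical r := by
  refine ⟨⟨rankAtLeast_canonical L, hL.not_rankAtLeast_canonical⟩, fun i hi => ?_⟩
  lift i to Fin (r + 1) using Nat.lt_succ_of_le hi
  refine ⟨L.endsRep i, hL.isEndsRep i, fun D hD => eq_endsRep hL hD, fun v => ?_⟩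
  rw [Finsupp.sub_apply, hL.endsRep_vertex, sub_self]

end Class

end ChainLengths

/-! ### A criterion for tropical independence -/

/-- A certificate of independence for the functions `F α` with `α ∈ S`: at the point `p α`, the
function `F α` is smaller than all the others. -/
def StrictlyMinimalAt {X κ : Type} (S : Finset κ) (F : κ → X → ℝ) (p : κ → X) : Prop :=
  ∀ α ∈ S, ∀ β ∈ S, α ≠ β → F α (p α) < F β (p α)

namespace StrictlyMinimalAt

section Independence

variable {X ι κ : Type} {S : Finset κ} {I : κ → ι} {ψ : ι → X → ℝ} {c : κ → ℝ} {p : κ → X}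
  (h : StrictlyMinimalAt S (fun α x => ψ (I α) x + c α) p)
include h

theorem injOn : Set.InjOn I S := by
  intro α hα β hβ hI
  by_contra hne
  have hαβ := h α hα β hβ hne
  have hβα := h β hβ α hα (Ne.symm hne)
  simp only [hI] at hαβ hβα
  linarith

theorem not_tropicallyDependent_image [Nonempty X] [DecidableEq ι] :
    ¬ TropicallyDependent (S.image I) ψ := by
  rintro ⟨b, hb⟩
  obtain ⟨i₀, hi₀, -⟩ := hb (Classical.arbitrary X)
  obtain ⟨α, hα, hmin⟩ :=
    S.exists_min_image (fun α => b (I α) - c α) (Finset.image_nonempty.1 ⟨i₀, hi₀⟩)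
  have hlt : ∀ δ ∈ S, α ≠ δ → ψ (I α) (p α) + b (I α) < ψ (I δ) (p α) + b (I δ) := by
    intro δ hδ hne
    linarith [h α hα δ hδ hne, hmin δ hδ]
  obtain ⟨i, hi, j, hj, hij, heq, hle⟩ := hb (p α)
  obtain ⟨β, hβ, rfl⟩ := Finset.mem_image.1 hi
  obtain ⟨γ, hγ, rfl⟩ := Finset.mem_image.1 hj
  rcases eq_or_ne α β with rfl | hβα
  · exact (hlt γ hγ fun h => hij (h ▸ rfl)).ne heq
  · exact (hle (I α) (Finset.mem_image_of_mem I hα)).not_gt (hlt β hβ hβα)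

end Independence

theorem subset {X κ : Type} {S S' : Finset κ} {F : κ → X → ℝ} {p : κ → X}
    (h : StrictlyMinimalAt S F p) (hS : S' ⊆ S) : StrictlyMinimalAt S' F p :=
  fun α hα β hβ => h α (hS hα) β (hS hβ)

theorem exists_not_tropicallyDependent {X ι κ : Type} [Nonempty X] {S : Finset κ} {I : κ → ι}
    {ψ : ι → X → ℝ} {c : κ → ℝ} {p : κ → X}
    (h : StrictlyMinimalAt S (fun α x => ψ (I α) x + c α) p) {N : ℕ} (hN : N ≤ S.card) :
    ∃ A : Finset ι, A.card = N ∧ ¬ TropicallyDependent A ψ := by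
  classical
  obtain ⟨S', hS', rfl⟩ := Finset.exists_subset_card_eq hN
  exact ⟨S'.image I, Finset.card_image_of_injOn (h.subset hS').injOn,
    (h.subset hS').not_tropicallyDependent_image⟩

theorem disjSum {X κ ι : Type} {S : Finset κ} {T : Finset ι} {F : κ → X → ℝ} {H : ι → X → ℝ}
    {p : κ → X} {q : ι → X} (hF : StrictlyMinimalAt S F p)
    (hlt : ∀ a ∈ T, ∀ i ∈ S, H a (q a) < F i (q a))
    (hp : ∀ a ∈ T, ∀ i ∈ S, ∃ j ∈ S, F j (p i) < H a (p i))
    (hq : ∀ a ∈ T, ∀ b ∈ T, a ≠ b → ∃ j ∈ S, F j (q b) < H a (q b)) :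
    StrictlyMinimalAt (S.disjSum T) (Sum.elim F H) (Sum.elim p q) := by
  rintro (i | a) hα (j | b) hβ hne <;>
    simp only [Finset.inl_mem_disjSum, Finset.inr_mem_disjSum] at hα hβ
  · exact hF i hα j hβ fun h => hne (h ▸ rfl)
  · obtain ⟨k, hk, hlt⟩ := hp b hβ i hα
    rcases eq_or_ne i k with rfl | hik
    · exact hlt
    · exact (hF i hα k hk hik).trans hlt
  · exact hlt a hα j hβ
  · obtain ⟨k, hk, hlt'⟩ := hq b hβ a hα fun h => hne (h ▸ rfl)
    exact (hlt a hα k hk).trans hlt'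

end StrictlyMinimalAt

/-! ### A walk along the bridges -/

namespace ChainLengths

open MetricGraph

variable {r : ℕ} (L : ChainLengths (r + 1))

/-- The part of the bridge `l` that is covered at time `u` by the walk from left to right that
traverses the bridge `l` at constant speed in the time interval `[l, l + 1]` and jumps over the
loops. -/
def covered (l : ℕ) (u : ℝ) : ℝ := L.n l * max 0 (min 1 (u - l))

/-- The distance walked at time `u`, the loops being passed along their bottom edges. -/
def walkDist (u : ℝ) : ℝ :=
  ∑ l ∈ Finset.range (r + 1), (L.covered l u + if (l : ℝ) + 1 ≤ u then L.m (l + 1) else 0)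

/-- The difference at time `u` between `endsValueAt (l - 1)` and `endsValueAt l`. -/
def drop (l : ℕ) (u : ℝ) : ℝ := L.walkDist u + L.covered l u

/-- The value at time `u` of the function whose values at the vertices `w_j` are given by
`endsValue i`. -/
def endsValueAt (i : ℕ) (u : ℝ) : ℝ :=
  ∑ l ∈ Finset.range (r + 1), (L.covered l u * (l - 1 - i + if i < l then 1 else 0)
    + (if (l : ℝ) + 1 ≤ u then L.m (l + 1) else 0) * (l - i))

/-- The position of the walk at time `u`, for `0 ≤ u < r + 1`. -/
def walkPoint (u : ℝ) : L.graph.Point :=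
  onEdge (L.bridge (Fin.ofNat (r + 1 + 1) ⌊u⌋₊)) (L.covered ⌊u⌋₊ u)

section Covered

variable {L} {l : ℕ} {u v : ℝ}

theorem covered_of_le (h : u ≤ l) : L.covered l u = 0 := by
  rw [covered, max_eq_left ((min_le_right _ _).trans (sub_nonpos.2 h)), mul_zero]

theorem covered_of_add_one_le (h : (l : ℝ) + 1 ≤ u) : L.covered l u = L.n l := by
  rw [covered, min_eq_left (le_sub_iff_add_le'.2 h), max_eq_right zero_le_one, mul_one]

theorem covered_of_mem_Icc (h : u ∈ Set.Icc (l : ℝ) (l + 1)) :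
    L.covered l u = L.n l * (u - l) := by
  rw [covered, min_eq_right (sub_le_iff_le_add'.2 h.2), max_eq_right (sub_nonneg.2 h.1)]

variable (hl : l ≤ r + 1)
include hl

theorem covered_mono : Monotone (L.covered l) := fun u v huv => by
  have := (L.n_pos l hl).le
  unfold covered
  gcongr

theorem covered_nonneg : 0 ≤ L.covered l u :=
  mul_nonneg (L.n_pos l hl).le (le_max_left _ _)

theorem covered_le : L.covered l u ≤ L.n l :=
  mul_le_of_le_one_right (L.n_pos l hl).le (max_le zero_le_one (min_le_left _ _))

theorem covered_lt_covered (h : u ∈ Set.Ico (l : ℝ) (l + 1)) (huv : u < v) :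
    L.covered l u < L.covered l v := by
  calc L.covered l u < L.covered l (min v (l + 1)) := by
        rw [covered_of_mem_Icc ⟨h.1, h.2.le⟩,
          covered_of_mem_Icc ⟨le_min (h.1.trans huv.le) (by linarith), min_le_right _ _⟩]
        exact mul_lt_mul_of_pos_left (sub_lt_sub_right (lt_min huv h.2) _) (L.n_pos l hl)
    _ ≤ L.covered l v := covered_mono hl (min_le_left _ _)

theorem covered_add_mul_le {δ : ℝ} (hv : v ∈ Set.Icc (l : ℝ) (l + 1)) (hδ : (l : ℝ) + δ ≤ v)
    (huv : u + δ ≤ v) : L.covered l u + L.n l * δ ≤ L.covered l v := by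
  rw [covered, covered_of_mem_Icc hv, ← mul_add]
  refine mul_le_mul_of_nonneg_left ?_ (L.n_pos l hl).le
  rw [← le_sub_iff_add_le]
  exact max_le (by linarith) ((min_le_right _ _).trans (by linarith))

end Covered

theorem covered_sub_le_walkDist_sub {l : ℕ} (hl : l ≤ r) {u v : ℝ} (huv : u ≤ v) :
    L.covered l v - L.covered l u ≤ L.walkDist v - L.walkDist u := by
  have hterm : ∀ k ∈ Finset.range (r + 1), L.covered k v - L.covered k u
      ≤ L.covered k v + (if (k : ℝ) + 1 ≤ v then L.m (k + 1) else 0)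
        - (L.covered k u + if (k : ℝ) + 1 ≤ u then L.m (k + 1) else 0) := by
    intro k hk
    have hk' : k ≤ r := Finset.mem_range_succ_iff.1 hk
    have := (L.m_pos (k + 1) (by omega) (by omega)).le
    split_ifs <;> linarith
  rw [walkDist, walkDist, ← Finset.sum_sub_distrib]
  refine le_trans ?_ (Finset.sum_le_sum hterm)
  exact Finset.single_le_sum (f := fun k => L.covered k v - L.covered k u)
    (fun k hk => sub_nonneg.2 (covered_mono (Finset.mem_range.1 hk).le huv))
    (Finset.mem_range_succ_iff.2 hl)

theorem walkDist_mono : Monotone L.walkDist := fun u v huv => by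
  have := L.covered_sub_le_walkDist_sub (Nat.zero_le r) huv
  have := covered_mono (L := L) (Nat.zero_le (r + 1)) huv
  linarith

theorem walkDist_strictMonoOn : StrictMonoOn L.walkDist (Set.Ico 0 (r + 1)) := by
  intro u hu v _ huv
  have hr : ⌊u⌋₊ ≤ r := Nat.lt_succ_iff.1 ((Nat.floor_lt hu.1).2 (by exact_mod_cast hu.2))
  have hdist := L.covered_sub_le_walkDist_sub hr huv.le
  have hlt := covered_lt_covered (L := L) (hr.trans r.le_succ)
    ⟨Nat.floor_le hu.1, Nat.lt_floor_add_one u⟩ huv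
  linarith

theorem drop_strictMonoOn {l : ℕ} (hl : l ≤ r + 1) :
    StrictMonoOn (L.drop l) (Set.Ico 0 (r + 1)) :=
  L.walkDist_strictMonoOn.add_monotone ((covered_mono hl).monotoneOn _)

theorem endsValueAt_sub_succ {i : ℕ} (hi : i < r) (u : ℝ) :
    L.endsValueAt i u - L.endsValueAt (i + 1) u = L.drop (i + 1) u := by
  have hcov : L.covered (i + 1) u
      = ∑ l ∈ Finset.range (r + 1), if l = i + 1 then L.covered l u else 0 := by
    rw [Finset.sum_ite_eq', if_pos (Finset.mem_range.2 (Nat.succ_lt_succ hi))]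
  rw [endsValueAt, endsValueAt, drop, walkDist, hcov, ← Finset.sum_sub_distrib,
    ← Finset.sum_add_distrib]
  refine Finset.sum_congr rfl fun l _ => ?_
  have hind : (if l = i + 1 then L.covered l u else 0)
      = L.covered l u * ((if i < l then 1 else 0) - if i + 1 < l then 1 else 0) := by
    split_ifs <;> first | omega | simp
  rw [hind]
  push_cast
  ring

theorem endsValueAt_eq {u : ℝ} (hu : u ∈ Set.Ico (0 : ℝ) (r + 1)) (i : ℕ) :
    L.endsValueAt i u = L.endsValue i ⌊u⌋₊
      + ((⌊u⌋₊ : ℝ) - 1 - i + if i < ⌊u⌋₊ then 1 else 0) * L.covered ⌊u⌋₊ u := by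
  have hr : ⌊u⌋₊ < r + 1 := (Nat.floor_lt hu.1).2 (by exact_mod_cast hu.2)
  have hlt := Nat.lt_floor_add_one u
  rw [endsValueAt, ← Finset.sum_subset (Finset.range_mono hr), Finset.sum_range_succ,
    if_neg hlt.not_ge, endsValue]
  · rw [zero_mul, add_zero, mul_comm (L.covered _ _)]
    congr 1
    refine Finset.sum_congr rfl fun l hl => ?_
    have hlu : (l : ℝ) + 1 ≤ u := le_trans (by exact_mod_cast Finset.mem_range.1 hl)
      (Nat.floor_le hu.1)
    rw [covered_of_add_one_le hlu, if_pos hlu]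
  · intro l _ hl
    have hlu : (⌊u⌋₊ : ℝ) + 1 ≤ l := by exact_mod_cast not_lt.1 (mt Finset.mem_range.2 hl)
    have hlu' : ¬ (l : ℝ) + 1 ≤ u := by linarith
    rw [covered_of_le (hlt.le.trans hlu), if_neg hlu', zero_mul, zero_mul, add_zero]

variable {L} in
theorem LongLoops.exists_isDiv_walkPoint (hL : L.LongLoops) (I : Multiset (Fin (r + 1))) :
    ∃ f : L.graph.Point → ℝ,
      IsDiv f ((I.map L.endsRep).sum - Multiset.card I • L.canonical) ∧
      ∀ u ∈ Set.Ico (0 : ℝ) (r + 1), f (L.walkPoint u)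
        = ((I.map Fin.val).map fun i => L.endsValueAt i u).sum := by
  obtain ⟨f, hf, hval⟩ := hL.exists_isDiv I
  refine ⟨f, hf, fun u hu => ?_⟩
  have hr : ⌊u⌋₊ < r + 1 + 1 :=
    ((Nat.floor_lt hu.1).2 (by exact_mod_cast hu.2)).trans (Nat.lt_succ_self _)
  have hj : ((Fin.ofNat (r + 1 + 1) ⌊u⌋₊ : Fin _) : ℕ) = ⌊u⌋₊ := by
    rw [Fin.val_ofNat, Nat.mod_eq_of_lt hr]
  rw [walkPoint, hval _ _ ?_, Multiset.map_map]
  · refine congrArg _ (Multiset.map_congr rfl fun i _ => ?_)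
    rw [hj, Function.comp_apply, L.endsValueAt_eq hu]
  · rw [hj]
    exact ⟨covered_nonneg (by omega), covered_le (by omega)⟩

end ChainLengths

/-! ### Windows -/

/-- The multiset of `m` natural numbers with sum `N` whose elements differ by at most one. -/
def window (m N : ℕ) : Multiset ℕ :=
  Multiset.replicate (m - N % m) (N / m) + Multiset.replicate (N % m) (N / m + 1)

/-- The multiset obtained from `s` by moving two of its elements `j` to `j - 1` and `j + 1`. -/
def spread (j : ℕ) (s : Multiset ℕ) : Multiset ℕ :=
  (j - 1) ::ₘ (j + 1) ::ₘ (s.erase j).erase j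

section Window

variable {m N : ℕ}

theorem card_window (hm : 0 < m) : Multiset.card (window m N) = m := by
  rw [window, Multiset.card_add, Multiset.card_replicate, Multiset.card_replicate,
    Nat.sub_add_cancel (Nat.mod_lt _ hm).le]

theorem window_mul_add {q : ℕ} (hq : q ≤ m) (hm : 0 < m) (k : ℕ) :
    window m (k * m + q) = Multiset.replicate (m - q) k + Multiset.replicate q (k + 1) := by
  rcases hq.lt_or_eq with hq | rfl
  · rw [window, Nat.mul_add_mod_of_lt hq, mul_comm k m, Nat.mul_add_div hm, Nat.div_eq_of_lt hq,
      add_zero]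
  · rw [← Nat.succ_mul, window, Nat.mul_mod_left, Nat.mul_div_cancel _ hm]
    simp

theorem exists_window_eq_cons (hm : 0 < m) (N : ℕ) :
    ∃ w, window m N = N / m ::ₘ w ∧ window m (N + 1) = (N / m + 1) ::ₘ w := by
  have hlt := Nat.mod_lt N hm
  refine ⟨Multiset.replicate (m - (N % m + 1)) (N / m)
    + Multiset.replicate (N % m) (N / m + 1), ?_, ?_⟩
  · rw [window, ← Multiset.cons_add, ← Multiset.replicate_succ]
    congr 2
    omega
  · rw [← Multiset.add_cons, ← Multiset.replicate_succ, ← window_mul_add hlt hm,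
      Nat.succ_eq_add_one, ← add_assoc, Nat.div_add_mod']

theorem le_of_mem_window {r i : ℕ} (hm : 0 < m) (hN : N ≤ r * m) (hi : i ∈ window m N) :
    i ≤ r := by
  rw [window, Multiset.mem_add, Multiset.mem_replicate, Multiset.mem_replicate] at hi
  rcases hi with ⟨-, rfl⟩ | ⟨hmod, rfl⟩
  · exact Nat.div_le_of_le_mul (by rwa [mul_comm])
  · exact (Nat.div_lt_iff_lt_mul hm).2 (by
      refine lt_of_le_of_ne hN fun h => hmod ?_
      rw [h, Nat.mul_mod_left])

end Window

section Spread

variable {j : ℕ} {s : Multiset ℕ}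

theorem cons_cons_erase_erase (h : 2 ≤ s.count j) : j ::ₘ j ::ₘ (s.erase j).erase j = s := by
  have hj : j ∈ s := Multiset.count_pos.1 (by omega)
  rw [Multiset.cons_erase, Multiset.cons_erase hj]
  rw [← Multiset.count_pos, Multiset.count_erase_self]
  omega

theorem card_spread (h : 2 ≤ s.count j) : Multiset.card (spread j s) = Multiset.card s := by
  conv_rhs => rw [← cons_cons_erase_erase h]
  simp only [spread, Multiset.card_cons]

theorem le_of_mem_spread {r i : ℕ} (hs : ∀ i ∈ s, i ≤ r) (hj : j < r) (hi : i ∈ spread j s) :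
    i ≤ r := by
  rcases Multiset.mem_cons.1 hi with rfl | hi
  · omega
  rcases Multiset.mem_cons.1 hi with rfl | hi
  · omega
  exact hs i (Multiset.mem_of_mem_erase (Multiset.mem_of_mem_erase hi))

end Spread

namespace ChainLengths

variable {r : ℕ} (L : ChainLengths (r + 1))

theorem sum_map_spread {j : ℕ} (hj : 1 ≤ j) (hjr : j < r) {s : Multiset ℕ} (hs : 2 ≤ s.count j)
    (u : ℝ) :
    ((spread j s).map fun i => L.endsValueAt i u).sum
      = (s.map fun i => L.endsValueAt i u).sum + (L.covered j u - L.covered (j + 1) u) := by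
  obtain ⟨k, rfl⟩ := Nat.exists_eq_add_of_le' hj
  conv_rhs => rw [← cons_cons_erase_erase hs]
  simp only [spread, Multiset.map_cons, Multiset.sum_cons, Nat.add_sub_cancel]
  have hk := L.endsValueAt_sub_succ (i := k) (by omega) u
  have hk' := L.endsValueAt_sub_succ hjr u
  rw [drop] at hk hk'
  linarith

end ChainLengths

/-- The time at which the `N`-th and the `N + 1`-st window function cross; the crossing is on the
bridge `N / m + 1`. -/
def crossTime (m N : ℕ) : ℝ := N / m + 1

/-- A time between the crossings of the `N`-th window function with its two neighbours. -/
def windowTime (m N : ℕ) : ℝ := crossTime m N - 1 / (2 * m)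

section CrossTime

variable {m N : ℕ}

theorem mul_add_lt_mul {r k q : ℕ} (hk : k < r) (hq : q < m) : k * m + q < r * m :=
  calc k * m + q < (k + 1) * m := by rw [Nat.succ_mul]; omega
    _ ≤ r * m := Nat.mul_le_mul_right m hk

theorem crossTime_strictMono (hm : 0 < m) : StrictMono (crossTime m) := fun a b hab => by
  have : (0 : ℝ) < m := Nat.cast_pos.2 hm
  unfold crossTime
  gcongr

theorem crossTime_mul_add (hm : 0 < m) (k q : ℕ) : crossTime m (k * m + q) = k + 1 + q / m := by
  have : (m : ℝ) ≠ 0 := Nat.cast_ne_zero.2 hm.ne'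
  rw [crossTime]
  push_cast
  field_simp
  ring

theorem crossTime_mem_Ico {r : ℕ} (hN : N < r * m) :
    crossTime m N ∈ Set.Ico (0 : ℝ) (r + 1) := by
  have hm : 0 < m := Nat.pos_of_mul_pos_left (Nat.zero_lt_of_lt hN)
  have : (N : ℝ) / m < r := by
    rw [div_lt_iff₀ (Nat.cast_pos.2 hm)]
    exact_mod_cast hN
  exact ⟨by unfold crossTime; positivity, by unfold crossTime; linarith⟩

theorem crossTime_mul_add_mem_Icc {k q : ℕ} (hq : q ∈ Set.Ico 1 m) :
    crossTime m (k * m + q) ∈ Set.Icc ((k : ℝ) + 1 + 1 / (2 * m)) (k + 2 - 1 / (2 * m)) := by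
  have hm : (0 : ℝ) < m := Nat.cast_pos.2 (Nat.zero_lt_of_lt hq.2)
  have h1 : (1 : ℝ) ≤ q := Nat.one_le_cast.2 hq.1
  have h2 : (q : ℝ) + 1 ≤ m := by exact_mod_cast hq.2
  rw [crossTime_mul_add (Nat.zero_lt_of_lt hq.2)]
  constructor
  · gcongr
    linarith
  · have hsum : (q : ℝ) / m + 1 / (2 * m) ≤ 1 := by
      rw [div_add_div _ _ hm.ne' (by positivity), div_le_one (by positivity)]
      nlinarith
    linarith

theorem windowTime_mem_Ico {r : ℕ} (hm : 0 < m) (hN : N ≤ r * m) :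
    windowTime m N ∈ Set.Ico (0 : ℝ) (r + 1) := by
  have hm' : (0 : ℝ) < m := Nat.cast_pos.2 hm
  have hm1 : (1 : ℝ) ≤ m := Nat.one_le_cast.2 hm
  have hhalf : 1 / (2 * (m : ℝ)) ≤ 1 := by
    rw [div_le_one (by positivity)]
    linarith
  have hhalf' : 0 < 1 / (2 * (m : ℝ)) := by positivity
  have hNr : (N : ℝ) / m ≤ r := by
    rw [div_le_iff₀ hm']
    exact_mod_cast hN
  have hN0 : 0 ≤ (N : ℝ) / m := by positivity
  constructor <;> unfold windowTime crossTime <;> linarith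

theorem crossTime_lt_windowTime_succ (hm : 0 < m) (N : ℕ) :
    crossTime m N < windowTime m (N + 1) := by
  have hm' : (0 : ℝ) < m := Nat.cast_pos.2 hm
  have hhalf : 1 / (2 * (m : ℝ)) < 1 / m := by
    apply one_div_lt_one_div_of_lt hm'
    linarith
  unfold windowTime crossTime
  push_cast
  rw [add_div]
  linarith

end CrossTime

namespace ChainLengths

variable {r : ℕ} (L : ChainLengths (r + 1)) {m : ℕ}

/-- The function with divisor `∑ i ∈ window m N, endsRep i - m • canonical` along the walk,
translated so that consecutive window functions cross at the times `crossTime`. -/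
def windowFun (m N : ℕ) (u : ℝ) : ℝ :=
  ((window m N).map fun i => L.endsValueAt i u).sum
    + ∑ a ∈ Finset.range N, L.drop (a / m + 1) (crossTime m a)

theorem windowFun_sub_succ {a : ℕ} (ha : a < r * m) (u : ℝ) :
    L.windowFun m a u - L.windowFun m (a + 1) u
      = L.drop (a / m + 1) u - L.drop (a / m + 1) (crossTime m a) := by
  have hm : 0 < m := Nat.pos_of_mul_pos_left (Nat.zero_lt_of_lt ha)
  obtain ⟨w, ha', hsucc⟩ := exists_window_eq_cons hm a
  have hdrop := L.endsValueAt_sub_succ ((Nat.div_lt_iff_lt_mul hm).2 ha) u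
  rw [windowFun, windowFun, ha', hsucc, Finset.sum_range_succ, Multiset.map_cons,
    Multiset.map_cons, Multiset.sum_cons, Multiset.sum_cons]
  linarith

theorem windowFun_crossTime {a : ℕ} (ha : a < r * m) :
    L.windowFun m a (crossTime m a) = L.windowFun m (a + 1) (crossTime m a) :=
  sub_eq_zero.1 ((L.windowFun_sub_succ ha _).trans (sub_self _))

theorem strictMonoOn_drop_of_lt {a : ℕ} (ha : a < r * m) :
    StrictMonoOn (L.drop (a / m + 1)) (Set.Ico 0 (r + 1)) :=
  L.drop_strictMonoOn (Nat.succ_le_succ (Nat.div_le_of_le_mul (by rw [mul_comm]; exact ha.le)))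

theorem windowFun_lt_of_lt_crossTime {a b : ℕ} (hab : a ≤ b) (hb : b < r * m) {u : ℝ} (hu : 0 ≤ u)
    (h : u < crossTime m a) : L.windowFun m a u < L.windowFun m (b + 1) u := by
  have hm : 0 < m := Nat.pos_of_mul_pos_left (Nat.zero_lt_of_lt hb)
  have hsucc : ∀ c, a ≤ c → c < r * m → L.windowFun m c u < L.windowFun m (c + 1) u := by
    intro c hac hc
    have hcross := crossTime_mem_Ico hc
    have huc := h.trans_le ((crossTime_strictMono hm).monotone hac)
    rw [← sub_neg, L.windowFun_sub_succ hc, sub_neg]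
    exact L.strictMonoOn_drop_of_lt hc ⟨hu, huc.trans hcross.2⟩ hcross huc
  induction b, hab using Nat.le_induction with
  | base => exact hsucc a le_rfl hb
  | succ b hab ih => exact (ih (by omega)).trans (hsucc _ (by omega) hb)

theorem windowFun_lt_of_crossTime_lt {a b : ℕ} (hab : a ≤ b) (hb : b < r * m) {u : ℝ}
    (hu : u < r + 1) (h : crossTime m b < u) : L.windowFun m (b + 1) u < L.windowFun m a u := by
  have hm : 0 < m := Nat.pos_of_mul_pos_left (Nat.zero_lt_of_lt hb)
  have hsucc : ∀ c, c ≤ b → L.windowFun m (c + 1) u < L.windowFun m c u := by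
    intro c hcb
    have hc := hcb.trans_lt hb
    have hcross := crossTime_mem_Ico hc
    have hcu := ((crossTime_strictMono hm).monotone hcb).trans_lt h
    rw [← sub_pos, L.windowFun_sub_succ hc, sub_pos]
    exact L.strictMonoOn_drop_of_lt hc hcross ⟨hcross.1.trans hcu.le, hu⟩ hcu
  suffices ∀ c, a ≤ c → c ≤ b → L.windowFun m (c + 1) u < L.windowFun m a u from this b hab le_rfl
  intro c hac
  induction c, hac using Nat.le_induction with
  | base => exact hsucc a
  | succ c _ ih => exact fun hcb => (hsucc _ hcb).trans (ih (by omega))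

theorem windowFun_le_of_lt_crossTime {a b : ℕ} (hab : a ≤ b) (hb : b ≤ r * m) {u : ℝ} (hu : 0 ≤ u)
    (h : u < crossTime m a) : L.windowFun m a u ≤ L.windowFun m b u := by
  rcases hab.eq_or_lt with rfl | hlt
  · exact le_rfl
  · obtain ⟨b, rfl⟩ := Nat.exists_eq_add_one_of_ne_zero (Nat.ne_zero_of_lt hlt)
    exact (L.windowFun_lt_of_lt_crossTime (Nat.le_of_lt_succ hlt) hb hu h).le

theorem windowFun_le_of_crossTime_le {a b : ℕ} (hab : a ≤ b) (hb : b ≤ r * m) {u : ℝ}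
    (hu : u < r + 1) (h : crossTime m b ≤ u) : L.windowFun m b u ≤ L.windowFun m a u := by
  rcases hab.eq_or_lt with rfl | hlt
  · exact le_rfl
  · obtain ⟨b, rfl⟩ := Nat.exists_eq_add_one_of_ne_zero (Nat.ne_zero_of_lt hlt)
    have hm : 0 < m := Nat.pos_of_mul_pos_left (Nat.zero_lt_of_lt hb)
    exact (L.windowFun_lt_of_crossTime_lt (Nat.le_of_lt_succ hlt) hb hu
      ((crossTime_strictMono hm b.lt_succ_self).trans_le h)).le

theorem windowFun_crossTime_le {a N : ℕ} (ha : a < r * m) (hN : N ≤ r * m) :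
    L.windowFun m a (crossTime m a) ≤ L.windowFun m N (crossTime m a) := by
  have hm : 0 < m := Nat.pos_of_mul_pos_left (Nat.zero_lt_of_lt ha)
  have hcross := crossTime_mem_Ico ha
  rcases le_or_gt N a with hNa | haN
  · exact L.windowFun_le_of_crossTime_le hNa ha.le hcross.2 le_rfl
  · rw [L.windowFun_crossTime ha]
    exact L.windowFun_le_of_lt_crossTime haN hN hcross.1 (crossTime_strictMono hm a.lt_succ_self)

theorem strictlyMinimalAt_windowFun (hm : 0 < m) :
    StrictlyMinimalAt (Finset.range (r * m + 1)) (L.windowFun m) (windowTime m) := by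
  intro N hN M hM hne
  rw [Finset.mem_range_succ_iff] at hN hM
  have hp := windowTime_mem_Ico hm hN
  rcases hne.lt_or_gt with hlt | hlt
  · obtain ⟨b, rfl⟩ := Nat.exists_eq_add_one_of_ne_zero (Nat.ne_zero_of_lt hlt)
    refine L.windowFun_lt_of_lt_crossTime (Nat.le_of_lt_succ hlt) hM hp.1 (sub_lt_self _ ?_)
    have : (0 : ℝ) < m := Nat.cast_pos.2 hm
    positivity
  · obtain ⟨b, rfl⟩ := Nat.exists_eq_add_one_of_ne_zero (Nat.ne_zero_of_lt hlt)
    exact L.windowFun_lt_of_crossTime_lt (Nat.le_of_lt_succ hlt) hN hp.2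
      (crossTime_lt_windowTime_succ hm b)

end ChainLengths

/-! ### Dips at the crossings of the windows -/

namespace ChainLengths

variable {r : ℕ} (L : ChainLengths (r + 1)) {m : ℕ}

/-- The effect at time `u` of moving two indices `j` to `j - 1` and `j + 1`, see `sum_map_spread`:
it grows along the bridge `j` and decreases along the bridge `j + 1`. -/
def kink (j : ℕ) (u : ℝ) : ℝ := L.covered j u - L.covered (j + 1) u

/-- By how much the function `dipFun m σ k q` dips below the window functions. -/
def dipDepth (m k : ℕ) : ℝ := L.n (k + 1) / (4 * m)

/-- A function that dips below all window functions near the crossing of the windows `k * m + q` and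
`k * m + q + 1` on the bridge `k + 1`. It is obtained from one of these two windows by spreading a
pair of equal indices, with `σ = 1` or `σ = 0` according to whether the kink grows or decreases
along this bridge. -/
def dipFun (m σ k q : ℕ) (u : ℝ) : ℝ :=
  L.windowFun m (k * m + q + σ) u
    + (L.kink (k + σ) u - L.kink (k + σ) (crossTime m (k * m + q))) - L.dipDepth m k

section DipFun

variable {k q : ℕ} (hk : k < r)
include hk

theorem dipDepth_pos (hm : 0 < m) : 0 < L.dipDepth m k :=
  div_pos (L.n_pos _ (by omega)) (mul_pos four_pos (Nat.cast_pos.2 hm))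

theorem dipFun_crossTime_lt (hq : q < m) {σ : ℕ} (hσ : σ ≤ 1) {N : ℕ} (hN : N ≤ r * m) :
    L.dipFun m σ k q (crossTime m (k * m + q)) < L.windowFun m N (crossTime m (k * m + q)) := by
  have ha := mul_add_lt_mul hk hq
  have hwindow : L.windowFun m (k * m + q + σ) (crossTime m (k * m + q))
      = L.windowFun m (k * m + q) (crossTime m (k * m + q)) := by
    interval_cases σ
    · rfl
    · exact (L.windowFun_crossTime ha).symm
  rw [dipFun, hwindow, sub_self, add_zero]
  exact (sub_lt_self _ (L.dipDepth_pos hk (Nat.zero_lt_of_lt hq))).trans_le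
    (L.windowFun_crossTime_le ha hN)

theorem windowFun_sub_succ_mul_add (hq : q < m) (u : ℝ) :
    L.windowFun m (k * m + q) u - L.windowFun m (k * m + q + 1) u
      = L.walkDist u + L.covered (k + 1) u
        - (L.walkDist (crossTime m (k * m + q))
          + L.covered (k + 1) (crossTime m (k * m + q))) := by
  have hdiv : (k * m + q) / m = k := by
    rw [mul_comm k m, Nat.mul_add_div (Nat.zero_lt_of_lt hq), Nat.div_eq_of_lt hq, add_zero]
  rw [L.windowFun_sub_succ (mul_add_lt_mul hk hq), hdiv, drop, drop]

end DipFun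

section CoveredCrossTime

variable {k q : ℕ} (hk : k < r) (hq : q ∈ Set.Ico 1 m) {u : ℝ}
include hk hq

theorem covered_add_dipDepth_lt {v : ℝ} (hv : v ∈ Set.Icc ((k : ℝ) + 1 + 1 / (2 * m)) (k + 2))
    (huv : u + 1 / (2 * m) ≤ v) :
    L.covered (k + 1) u + L.dipDepth m k < L.covered (k + 1) v := by
  have hm : (0 : ℝ) < m := Nat.cast_pos.2 (Nat.zero_lt_of_lt hq.2)
  have hδ : 0 < 1 / (2 * (m : ℝ)) := by positivity
  have hdepth : L.n (k + 1) * (1 / (2 * m)) = 2 * L.dipDepth m k := by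
    rw [dipDepth]
    field_simp
    norm_num
  have hpos := L.dipDepth_pos hk (Nat.zero_lt_of_lt hq.2)
  have hgain : L.covered (k + 1) u + L.n (k + 1) * (1 / (2 * m)) ≤ L.covered (k + 1) v :=
    covered_add_mul_le (by omega) ⟨by push_cast; linarith [hv.1], by push_cast; linarith [hv.2]⟩
      (by push_cast; exact hv.1) huv
  linarith

theorem covered_add_dipDepth_lt_covered_crossTime (h : u + 1 / (2 * m) ≤ crossTime m (k * m + q)) :
    L.covered (k + 1) u + L.dipDepth m k < L.covered (k + 1) (crossTime m (k * m + q)) := by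
  have hc := crossTime_mul_add_mem_Icc (k := k) hq
  exact L.covered_add_dipDepth_lt hk hq ⟨hc.1, hc.2.trans (sub_le_self _ (by positivity))⟩ h

theorem covered_crossTime_add_dipDepth_lt (h : crossTime m (k * m + q) + 1 / (2 * m) ≤ u) :
    L.covered (k + 1) (crossTime m (k * m + q)) + L.dipDepth m k < L.covered (k + 1) u := by
  have hc := crossTime_mul_add_mem_Icc (k := k) hq
  refine lt_of_lt_of_le (L.covered_add_dipDepth_lt hk hq
    ⟨hc.1.trans ?_, by linarith [hc.2]⟩ le_rfl) (covered_mono (by omega) h)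
  exact le_add_of_nonneg_right (by positivity)

end CoveredCrossTime

theorem exists_windowFun_lt_dipFun_one {k q : ℕ} (hk : k + 1 < r) (hq : q ∈ Set.Ico 1 m) {u : ℝ}
    (hu : u < r + 1) (h : 1 / (2 * m) ≤ |u - crossTime m (k * m + q)|) :
    ∃ N ≤ r * m, L.windowFun m N u < L.dipFun m 1 k q u := by
  have hkr := Nat.lt_of_succ_lt hk
  have ha := mul_add_lt_mul hkr hq.2
  have hδ : 0 ≤ 1 / (2 * (m : ℝ)) := by positivity
  have hc := crossTime_mul_add_mem_Icc (k := k) hq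
  have hsucc := L.windowFun_sub_succ_mul_add hkr hq.2 u
  have hleft := L.covered_add_dipDepth_lt_covered_crossTime hkr hq (u := u)
  have hright := L.covered_crossTime_add_dipDepth_lt hkr hq (u := u)
  have hcov {v : ℝ} (hv : v ≤ k + 2) : L.covered (k + 1 + 1) v = 0 :=
    covered_of_le (by push_cast; linarith)
  rw [dipFun, kink, kink, hcov (hc.2.trans (sub_le_self _ hδ))]
  rcases le_abs.1 h with h | h
  · have hgain := hright (by linarith)
    rcases le_or_gt u (k + 2) with hu2 | hu2
    · exact ⟨k * m + q + 1, ha, by linarith [hcov hu2]⟩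
    · have hm : 0 < m := Nat.zero_lt_of_lt hq.2
      have hcross : crossTime m ((k + 1) * m + 0) = k + 2 := by
        rw [crossTime_mul_add hm]
        push_cast
        ring
      have hstep := L.windowFun_sub_succ_mul_add hk hm u
      have hanti := L.windowFun_le_of_crossTime_le (a := k * m + q + 1) (b := (k + 1) * m + 0)
        (by rw [Nat.succ_mul]; have := hq.2; omega) (mul_add_lt_mul hk hm).le hu
        (by rw [hcross]; exact hu2.le)
      rw [hcross, hcov le_rfl] at hstep
      exact ⟨(k + 1) * m + 0 + 1, mul_add_lt_mul hk hm, by linarith [L.walkDist_mono hu2.le]⟩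
  · have hdist := L.covered_sub_le_walkDist_sub (l := k + 1) hk.le (u := u)
      (v := crossTime m (k * m + q)) (by linarith)
    exact ⟨k * m + q, ha.le, by linarith [hleft (by linarith), hcov (v := u) (by linarith [hc.2])]⟩

theorem exists_windowFun_lt_dipFun_zero {k q : ℕ} (hk : k < r) (hq : q ∈ Set.Ico 1 m) {u : ℝ}
    (hu : 0 ≤ u) (h : 1 / (2 * m) ≤ |u - crossTime m (k * m + q)|) :
    ∃ N ≤ r * m, L.windowFun m N u < L.dipFun m 0 k q u := by
  have ha := mul_add_lt_mul hk hq.2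
  have hδ : 0 ≤ 1 / (2 * (m : ℝ)) := by positivity
  have hc := crossTime_mul_add_mem_Icc (k := k) hq
  have hsucc := L.windowFun_sub_succ_mul_add hk hq.2 u
  have hleft := L.covered_add_dipDepth_lt_covered_crossTime hk hq (u := u)
  have hright := L.covered_crossTime_add_dipDepth_lt hk hq (u := u)
  have hcov {v : ℝ} (hv : k + 1 ≤ v) : L.covered k v = L.n k := covered_of_add_one_le hv
  rw [dipFun, kink, kink, add_zero, add_zero, hcov (le_trans (le_add_of_nonneg_right hδ) hc.1)]
  rcases le_abs.1 h with h | h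
  · have hdist := L.covered_sub_le_walkDist_sub (l := k + 1) hk (u := crossTime m (k * m + q))
      (v := u) (by linarith)
    exact ⟨k * m + q + 1, ha,
      by linarith [hright (by linarith), hcov (v := u) (by linarith [hc.1])]⟩
  · have hgain := hleft (by linarith)
    rcases le_or_gt (k + 1 : ℝ) u with hu1 | hu1
    · exact ⟨k * m + q, ha.le, by linarith [hcov hu1]⟩
    · have hm : 0 < m := Nat.zero_lt_of_lt hq.2
      have hcross : crossTime m (k * m + 0) = k + 1 := by
        rw [crossTime_mul_add hm, Nat.cast_zero, zero_div, add_zero]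
      have hstep := L.windowFun_sub_succ_mul_add hk hm u
      have hmono := L.windowFun_le_of_lt_crossTime (a := k * m + 0 + 1) (b := k * m + q)
        (by have := hq.1; omega) ha.le hu
        (by
          refine hu1.trans ?_
          rw [← hcross]
          exact crossTime_strictMono hm (Nat.lt_succ_self _))
      have hdist := L.covered_sub_le_walkDist_sub hk.le hu1.le
      have hcov_succ : ∀ v : ℝ, v ≤ k + 1 → L.covered (k + 1) v = 0 := fun v hv =>
        covered_of_le (by push_cast; linarith)
      rw [hcross, hcov_succ _ le_rfl, hcov_succ u hu1.le] at hstep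
      rw [hcov_succ u hu1.le] at hgain ⊢
      rw [hcov le_rfl] at hdist
      exact ⟨k * m + 0, (mul_add_lt_mul hk hm).le, by linarith⟩

end ChainLengths

/-- The pairs `(k, q)` for which there is a dip near the crossing of the windows `k * m + q` and
`k * m + q + 1`. -/
def dips (r m : ℕ) : Finset (ℕ × ℕ) :=
  (Finset.range r ×ˢ Finset.Ico 1 m).filter fun x => x.1 + 1 < r ∨ 1 ≤ x.1 ∧ x.2 + 1 < m

/-- The parameter `σ` for the dips on the bridge `k + 1`: only the last of the bridges needs
`σ = 0`. -/
def dipSide (r k : ℕ) : ℕ := if k + 1 < r then 1 else 0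

theorem dipSide_le_one (r k : ℕ) : dipSide r k ≤ 1 := by
  unfold dipSide
  split_ifs <;> omega

section Dips

variable {r m : ℕ} {x : ℕ × ℕ}

theorem fst_lt_of_mem_dips (hx : x ∈ dips r m) : x.1 < r :=
  Finset.mem_range.1 (Finset.mem_product.1 (Finset.mem_of_mem_filter x hx)).1

theorem snd_mem_of_mem_dips (hx : x ∈ dips r m) : x.2 ∈ Set.Ico 1 m :=
  Finset.mem_Ico.1 (Finset.mem_product.1 (Finset.mem_of_mem_filter x hx)).2

theorem mul_add_injOn_dips : Set.InjOn (fun x : ℕ × ℕ => x.1 * m + x.2) (dips r m) := by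
  intro x hx y hy h
  have hx' := (snd_mem_of_mem_dips hx).2
  have hy' := (snd_mem_of_mem_dips hy).2
  have hsnd : x.2 = y.2 := by
    rw [← Nat.mul_add_mod_of_lt (a := x.1) hx', ← Nat.mul_add_mod_of_lt (a := y.1) hy']
    exact congrArg (· % m) h
  refine Prod.ext (Nat.eq_of_mul_eq_mul_right (Nat.zero_lt_of_lt hx') ?_) hsnd
  simp only [hsnd] at h
  omega

theorem le_card_dips_add_one (hr : 2 ≤ r) : r * (m - 1) ≤ (dips r m).card + 1 := by
  have hsub : (Finset.range r ×ˢ Finset.Ico 1 m).erase (r - 1, m - 1) ⊆ dips r m := by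
    intro x hx
    obtain ⟨hne, hx⟩ := Finset.mem_erase.1 hx
    refine Finset.mem_filter.2 ⟨hx, ?_⟩
    rw [Finset.mem_product, Finset.mem_range, Finset.mem_Ico] at hx
    rw [ne_eq, Prod.ext_iff] at hne
    dsimp only at hne
    omega
  have hcard := Finset.pred_card_le_card_erase.trans (Finset.card_le_card hsub)
  rw [Finset.card_product, Finset.card_range, Nat.card_Ico] at hcard
  omega

theorem two_le_count_window (hx : x ∈ dips r m) :
    2 ≤ (window m (x.1 * m + x.2 + dipSide r x.1)).count (x.1 + dipSide r x.1) := by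
  have hq := snd_mem_of_mem_dips hx
  have hq1 := hq.1
  have hm : 0 < m := Nat.zero_lt_of_lt hq.2
  have hcases := (Finset.mem_filter.1 hx).2
  rw [dipSide]
  split_ifs with h
  · rw [add_assoc, window_mul_add hq.2 hm, Multiset.count_add, Multiset.count_replicate_self]
    omega
  · rw [add_zero, add_zero, window_mul_add hq.2.le hm, Multiset.count_add,
      Multiset.count_replicate_self]
    omega

theorem one_div_le_abs_intCast_div {z : ℤ} (hz : z ≠ 0) :
    1 / (2 * (m : ℝ)) ≤ |(z : ℝ) / (2 * m)| := by
  rw [abs_div, abs_of_nonneg (by positivity : (0 : ℝ) ≤ 2 * m)]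
  gcongr
  exact_mod_cast Int.one_le_abs hz

theorem le_abs_crossTime_sub (hm : 0 < m) {a b : ℕ} (hab : a ≠ b) :
    1 / (2 * (m : ℝ)) ≤ |crossTime m a - crossTime m b| := by
  have hm' : (m : ℝ) ≠ 0 := Nat.cast_ne_zero.2 hm.ne'
  convert one_div_le_abs_intCast_div (m := m) (z := 2 * ((a : ℤ) - b)) (by omega) using 2
  unfold crossTime
  push_cast
  field_simp
  ring

theorem le_abs_windowTime_sub_crossTime (hm : 0 < m) (N a : ℕ) :
    1 / (2 * (m : ℝ)) ≤ |windowTime m N - crossTime m a| := by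
  have hm' : (m : ℝ) ≠ 0 := Nat.cast_ne_zero.2 hm.ne'
  convert one_div_le_abs_intCast_div (m := m) (z := 2 * ((N : ℤ) - a) - 1) (by omega) using 2
  unfold windowTime crossTime
  push_cast
  field_simp
  ring

end Dips

namespace ChainLengths

variable {r : ℕ} (L : ChainLengths (r + 1)) {m : ℕ}

theorem exists_windowFun_lt_dipFun {x : ℕ × ℕ} (hx : x ∈ dips r m) {u : ℝ}
    (hu : u ∈ Set.Ico (0 : ℝ) (r + 1)) (h : 1 / (2 * m) ≤ |u - crossTime m (x.1 * m + x.2)|) :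
    ∃ N ∈ Finset.range (r * m + 1),
      L.windowFun m N u < L.dipFun m (dipSide r x.1) x.1 x.2 u := by
  have hk := fst_lt_of_mem_dips hx
  have hq := snd_mem_of_mem_dips hx
  simp only [Finset.mem_range_succ_iff]
  rw [dipSide]
  split_ifs with hk'
  · exact L.exists_windowFun_lt_dipFun_one hk' hq hu.2 h
  · exact L.exists_windowFun_lt_dipFun_zero hk hq hu.1 h

/-- The window functions and the dip functions. -/
def familyFun (m : ℕ) : ℕ ⊕ ℕ × ℕ → ℝ → ℝ :=
  Sum.elim (L.windowFun m) fun x => L.dipFun m (dipSide r x.1) x.1 x.2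

theorem strictlyMinimalAt_familyFun (hm : 0 < m) :
    StrictlyMinimalAt ((Finset.range (r * m + 1)).disjSum (dips r m)) (L.familyFun m)
      (Sum.elim (windowTime m) fun x => crossTime m (x.1 * m + x.2)) := by
  refine (L.strictlyMinimalAt_windowFun hm).disjSum (fun x hx N hN => ?_) (fun x hx N hN => ?_)
    fun x hx y hy hxy => ?_
  · exact L.dipFun_crossTime_lt (fst_lt_of_mem_dips hx) (snd_mem_of_mem_dips hx).2
      (dipSide_le_one r x.1) (Finset.mem_range_succ_iff.1 hN)
  · exact L.exists_windowFun_lt_dipFun hx (windowTime_mem_Ico hm (Finset.mem_range_succ_iff.1 hN))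
      (le_abs_windowTime_sub_crossTime hm _ _)
  · exact L.exists_windowFun_lt_dipFun hx
      (crossTime_mem_Ico (mul_add_lt_mul (fst_lt_of_mem_dips hy) (snd_mem_of_mem_dips hy).2))
      (le_abs_crossTime_sub hm (mul_add_injOn_dips.ne hy hx hxy.symm))

end ChainLengths

theorem exists_sym_map_val {r m : ℕ} {s : Multiset ℕ} (hs : Multiset.card s = m)
    (hle : ∀ i ∈ s, i ≤ r) :
    ∃ I : Sym (Fin (r + 1)) m, (I : Multiset (Fin (r + 1))).map Fin.val = s := by
  lift s to Multiset (Fin (r + 1)) using fun i hi => Nat.lt_succ_of_le (hle i hi)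
  exact ⟨⟨s, by rw [← hs, Multiset.card_map]⟩, rfl⟩

namespace ChainLengths

variable {r : ℕ} (L : ChainLengths (r + 1)) {m : ℕ}

theorem exists_familyFun_eq (hm : 0 < m) {α : ℕ ⊕ ℕ × ℕ}
    (hα : α ∈ (Finset.range (r * m + 1)).disjSum (dips r m)) :
    ∃ (I : Sym (Fin (r + 1)) m) (c : ℝ), ∀ u, L.familyFun m α u
      = (((I : Multiset (Fin (r + 1))).map Fin.val).map fun i => L.endsValueAt i u).sum + c := by
  rcases α with N | x
  · rw [Finset.inl_mem_disjSum, Finset.mem_range_succ_iff] at hα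
    obtain ⟨I, hI⟩ := exists_sym_map_val (card_window hm) fun i => le_of_mem_window hm hα
    exact ⟨I, _, fun u => by rw [hI]; rfl⟩
  · rw [Finset.inr_mem_disjSum] at hα
    have hcount := two_le_count_window hα
    have hcases := (Finset.mem_filter.1 hα).2
    have hk := fst_lt_of_mem_dips hα
    have hσ : 1 ≤ x.1 + dipSide r x.1 ∧ x.1 + dipSide r x.1 < r := by
      rw [dipSide]
      split_ifs <;> omega
    have hN : x.1 * m + x.2 + dipSide r x.1 ≤ r * m :=
      (Nat.add_le_add_left (dipSide_le_one r x.1) _).trans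
        (mul_add_lt_mul hk (snd_mem_of_mem_dips hα).2)
    obtain ⟨I, hI⟩ := exists_sym_map_val ((card_spread hcount).trans (card_window hm))
      fun i => le_of_mem_spread (fun i => le_of_mem_window hm hN) hσ.2
    refine ⟨I, ∑ a ∈ Finset.range (x.1 * m + x.2 + dipSide r x.1),
        L.drop (a / m + 1) (crossTime m a)
      - L.kink (x.1 + dipSide r x.1) (crossTime m (x.1 * m + x.2)) - L.dipDepth m x.1,
      fun u => ?_⟩
    rw [hI, L.sum_map_spread hσ.1 hσ.2 hcount, familyFun, Sum.elim_inr, dipFun, windowFun, kink]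
    ring

theorem exists_not_tropicallyDependent (hm : 0 < m)
    {ψ : Sym (Fin (r + 1)) m → L.graph.Point → ℝ}
    (hψ : ∀ I, ∀ u ∈ Set.Ico (0 : ℝ) (r + 1), ψ I (L.walkPoint u)
      = (((I : Multiset (Fin (r + 1))).map Fin.val).map fun i => L.endsValueAt i u).sum)
    {N : ℕ} (hN : N ≤ r * m + 1 + (dips r m).card) :
    ∃ A : Finset (Sym (Fin (r + 1)) m), A.card = N ∧ ¬ TropicallyDependent A ψ := by
  set S := (Finset.range (r * m + 1)).disjSum (dips r m) with hS
  set p : ℕ ⊕ ℕ × ℕ → ℝ := Sum.elim (windowTime m) fun x => crossTime m (x.1 * m + x.2)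
  have hpS : ∀ α ∈ S, p α ∈ Set.Ico (0 : ℝ) (r + 1) := by
    rintro (N | x) hα
    · exact windowTime_mem_Ico hm (Finset.mem_range_succ_iff.1 (Finset.inl_mem_disjSum.1 hα))
    · have hx := Finset.inr_mem_disjSum.1 hα
      exact crossTime_mem_Ico (mul_add_lt_mul (fst_lt_of_mem_dips hx) (snd_mem_of_mem_dips hx).2)
  choose! I c hI using fun α (hα : α ∈ S) => L.exists_familyFun_eq hm hα
  have hmin : StrictlyMinimalAt S (fun α x => ψ (I α) x + c α) (L.walkPoint ∘ p) := by
    intro α hα β hβ hne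
    simp only [Function.comp_apply, hψ _ _ (hpS α hα), ← hI α hα, ← hI β hβ]
    exact L.strictlyMinimalAt_familyFun hm α hα β hβ hne
  have : Nonempty L.graph.Point := ⟨L.leftEnd⟩
  exact hmin.exists_not_tropicallyDependent (by rwa [hS, Finset.card_disjSum, Finset.card_range])

end ChainLengths

theorem min_choose_le_card {r m : ℕ} (hm : 0 < m) :
    min (((r + m).choose m : ℕ) : ℤ) (m * (2 * r : ℕ) - (r + 1 : ℕ) + 1)
      ≤ (r * m + 1 + (dips r m).card : ℕ) := by
  rcases lt_or_ge r 2 with hr | hr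
  · have hchoose : (r + m).choose m = r * m + 1 := by
      interval_cases r
      · simp
      · rw [add_comm, Nat.choose_succ_self_right, one_mul]
    refine (min_le_left _ _).trans (Nat.cast_le.2 ?_)
    omega
  · refine (min_le_right _ _).trans ?_
    have hcard := le_card_dips_add_one (m := m) hr
    zify [hm] at hcard
    push_cast
    linarith

theorem theorem1p5_general {r m : ℕ} (hm : 1 ≤ m) (L : ChainLengths (r + 1)) (hL : L.LongLoops) :
    ∃ D : L.graph.Divisor, MetricGraph.deg D = (2 * r : ℕ) ∧ L.IsVertexAvoiding D r ∧
      ∃ Di : Fin (r + 1) → L.graph.Divisor, (∀ i : Fin (r + 1), L.IsEndsRep D r i (Di i)) ∧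
      ∃ ψ : Sym (Fin (r + 1)) m → L.graph.Point → ℝ,
        (∀ I, MetricGraph.IsDiv (ψ I) (((I : Multiset (Fin (r + 1))).map Di).sum - m • D)) ∧
      ∃ A : Finset (Sym (Fin (r + 1)) m),
        (A.card : ℤ) = min (((r + m).choose m : ℕ) : ℤ) ((m : ℤ) * (2 * r : ℕ) - (r + 1 : ℕ) + 1) ∧
        ¬ TropicallyDependent A ψ := by
  choose ψ hdiv hval using fun I : Sym (Fin (r + 1)) m => hL.exists_isDiv_walkPoint I
  have hpos : 0 ≤ min (((r + m).choose m : ℕ) : ℤ) ((m : ℤ) * (2 * r : ℕ) - (r + 1 : ℕ) + 1) := by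
    refine le_min (Int.natCast_nonneg _) ?_
    push_cast
    nlinarith
  obtain ⟨N, hN⟩ := Int.eq_ofNat_of_zero_le hpos
  obtain ⟨A, hA, hdep⟩ := L.exists_not_tropicallyDependent hm hval
    (Int.ofNat_le.1 (hN.symm.trans_le (min_choose_le_card hm)))
  refine ⟨L.canonical, ?_, hL.isVertexAvoiding_canonical, L.endsRep, hL.isEndsRep, ψ, fun I => ?_,
    A, by rw [hN, hA], hdep⟩
  · rw [ChainLengths.deg_canonical]
    push_cast
    ring
  · simpa only [Sym.card_coe] using hdiv I

end

/-- The tropical maximal rank conjecture holds for the canonical divisor, in every degree `m`. -/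
theorem theorem1p5 (g r d m : ℕ) (hg : 3 ≤ g) (hm : 1 ≤ m) (hr : r = g - 1) (hd : d = 2 * g - 2) :
    TropicalMaximalRank g r d m := by
  obtain rfl : g = r + 1 := by omega
  obtain rfl : d = 2 * r := by omega
  refine ⟨1, one_pos, fun L h => theorem1p5_general hm L fun k => ?_⟩
  have hmk := L.m_pos (k + 1) (by omega) (by omega)
  have := h.bottom_lt_top (k + 1) (by omega) (by omega)
  push_cast at this
  nlinarith
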